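/- **Setting.** Consider an $N$-player stochastic Nash game in which player $i$ has strategy set $X_i\subseteq\mathbb R^{n_i}$ and payoff $f_i(x)=\mathbb E[\psi_i(x;\xi)]$, to be minimized over $x_i\in X_i$, where $\xi$ is a random vector in $\mathbb R^d$; put $X=\prod_i X_i$. Suppose that for every $i$: (a) $X_i$ is compact and convex; (b) for every $x_{-i}\in X_{-i}$, $f_i(\cdot,x_{-i})$ is (well defined,) convex and twice continuously differentiable over an open set containing $X_i$; (c) for every $x_{-i}\in X_{-i}$ and every outcome, $\psi_i(\cdot,x_{-i};\xi)$ is differentiable over an open set containing $X_i$; $(x,s)\mapsto\nabla_{x_i}\psi_i(x;s)$ is measurable on $X\times\mathbb R^d$, and $\nabla_{x_i}f_i(x)=\mathbb E[\nabla_{x_i}\psi_i(x;\xi)]$ for $x\in X$; (d) there is $M_i>0$ with $\mathbb E[\|\nabla_{x_i}\psi_i(x;\xi)\|^2]\le M_i^2$ for all $x\in X$. Let $\mu>0$, $\zeta_{i,\min}=\inf_{x\in X}\lambda_{\min}(\nabla^2_{x_i}f_i(x))$ and, for $j\ne i$, $\zeta_{ij,\max}=\sup_{x\in X}\|\nabla^2_{x_ix_j}f_i(x)\|$,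 where these mixed second derivatives exist on $X$ and the suprema are finite. Let $\Gamma\in\mathbb R^{N\times N}$ have diagonal entries $\mu/(\mu+\zeta_{i,\min})$ and off-diagonal entries $\zeta_{ij,\max}/(\mu+\zeta_{i,\min})$, and suppose that $a:=\|\Gamma\|<1$ (spectral norm). Let $\widehat x_i(y)=\operatorname{argmin}_{u\in X_i}\big[f_i(u,y_{-i})+\tfrac\mu2\|u-y_i\|^2\big]$, $Q_i=2M_i^2/\mu^2+2D_{X_i}^2$ with $D_{X_i}$ the diameter of $X_i$, and $\eta\in(a,1)$. **Scheme.** Start from a (possibly random) $x_0\in X$. At stage $k=0,1,2,\dots$ every player $i$ sets $z_{i,1}=x_{i,k}$ and takes $j_{i,k}=\lceil Q_i/\eta^{2(k+1)}\rceil$ projected stochastic gradient steps $$z_{i,t+1}=\Pi_{X_i}\Big[z_{i,t}-\tfrac1{\mu(t+1)}\big(\nabla_{x_i}\psi_i(z_{i,t},x_{-i,k};\xi_{i,k}^t)+\mu(z_{i,t}-x_{i,k})\big)\Big],\qquad t=1,\dots,j_{i,k},$$ and sets $x_{i,k+1}=z_{i,j_{i,k}+1}$. Here each sample $\xi_{i,k}^t$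 has the law of $\xi$ and is independent of $\mathcal F_k$ and $\xi_{i,k}^1,\dots,\xi_{i,k}^{t-1}$ jointly, where $\mathcal F_k$ is the $\sigma$-field generated by $x_0$ and the samples used by all players before stage $k$. **Statement.** The game has a unique Nash equilibrium $x^*$, and the following hold. 1. For all $i$ and $k$, $x_{i,k+1}\in X_i$ and $\mathbb E\big[\|x_{i,k+1}-\widehat x_i(x_k)\|^2\,\big|\,\mathcal F_k\big]\le\eta^{2(k+1)}$ almost surely. 2. Let $C\ge0$ satisfy $\mathbb E[\|x_{i,0}-x_i^*\|^2]\le C^2$ for all $i$ (for a deterministic $x_0$: $\|x_{i,0}-x_i^*\|\le C$). Then for every $\epsilon>0$ there is a number $K$ of stages such that for every $k\ge K$ the profile $x_k$ is an $\epsilon$-NE$_2$, that is, $$\mathbb E\big\|\big(\|x_{1,k}-x_1^*\|,\dots,\|x_{N,k}-x_N^*\|\big)\big\|\le\epsilon ,$$ and for every player $i$ the number $\sum_{k<K}j_{i,k}$ of projected gradient steps taken in the first $K$ stages is at most $$\frac{Q_i}{\eta^4\ln(1/\eta^2)}\left(\frac{\sqrt N\big(C+\frac{\eta}{\eta-a}\big)}{\epsilon}\right)^2+\left\lceil\frac{\ln\!\Big(\frac{\sqrt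 N}{\epsilon}\big(C+\frac{\eta}{\eta-a}\big)\Big)}{\ln(1/\eta)}\right\rceil_+ ,\qquad \lceil r\rceil_+=\max(\lceil r\rceil,0).$$ 3. With $Q_i,\eta,a,C$ fixed, this bound is $O(N/\epsilon^2)$, uniformly over integers $N\ge1$ and $\epsilon\in(0,1]$. -/

import Mathlib

open MeasureTheory ProbabilityTheory

noncomputable section

/-- A strategy profile `x = (x_1, …, x_N)` with `x_i ∈ ℝ^{n_i}`. -/
abbrev Profile {N : ℕ} (n : Fin N → ℕ) : Type :=
  (i : Fin N) → EuclideanSpace ℝ (Fin (n i))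

/-- The data of an `N`-player stochastic Nash game: strategy sets `X_i ⊆ ℝ^{n_i}`, sampled payoffs
`ψ_i(x; s)`, and a random vector `ξ : Ω → ℝ^d` on a probability space `(Ω, P)`. -/
structure StochGame {N : ℕ} (n : Fin N → ℕ) (d : ℕ) (Ω : Type*) [MeasurableSpace Ω] where
  P : Measure Ω
  X : (i : Fin N) → Set (EuclideanSpace ℝ (Fin (n i)))
  ψ : Fin N → Profile n → EuclideanSpace ℝ (Fin d) → ℝ
  ξ : Ω → EuclideanSpace ℝ (Fin d)

/-- The partial gradient `∇_{x_i} h (x)`. -/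
def partialGrad {N : ℕ} {n : Fin N → ℕ} (h : Profile n → ℝ) (i : Fin N) (x : Profile n) :
    EuclideanSpace ℝ (Fin (n i)) :=
  gradient (fun u => h (Function.update x i u)) (x i)

/-- The block `∇²_{x_i x_j} h (x)` of the Hessian: the derivative of `∇_{x_i} h` in `x_j`. -/
def hessBlock {N : ℕ} {n : Fin N → ℕ} (h : Profile n → ℝ) (i j : Fin N) (x : Profile n) :
    EuclideanSpace ℝ (Fin (n j)) →L[ℝ] EuclideanSpace ℝ (Fin (n i)) :=
  fderiv ℝ (fun u => partialGrad h i (Function.update x j u)) (x j)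

/-- The smallest eigenvalue of a (symmetric) operator. -/
def lamMin {m : ℕ} (A : EuclideanSpace ℝ (Fin m) →L[ℝ] EuclideanSpace ℝ (Fin m)) : ℝ :=
  sInf {l : ℝ |
    Module.End.HasEigenvalue (A : EuclideanSpace ℝ (Fin m) →ₗ[ℝ] EuclideanSpace ℝ (Fin m)) l}

/-- The Euclidean projection onto `K`: the point of `K` nearest to `u`. -/
def nearestPt {m : ℕ} (K : Set (EuclideanSpace ℝ (Fin m))) (u : EuclideanSpace ℝ (Fin m)) :
    EuclideanSpace ℝ (Fin m) :=
  Classical.epsilon fun z => z ∈ K ∧ ∀ w ∈ K, ‖u - z‖ ≤ ‖u - w‖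

/-- The distance vector `(‖x_1 - y_1‖, …, ‖x_N - y_N‖)` in Euclidean `ℝ^N`. -/
def distVec {N : ℕ} {n : Fin N → ℕ} (x y : Profile n) : EuclideanSpace ℝ (Fin N) :=
  WithLp.toLp 2 fun i => ‖x i - y i‖

namespace StochGame

variable {N : ℕ} {n : Fin N → ℕ} {d : ℕ} {Ω : Type*} [MeasurableSpace Ω]

/-- The set `X = ∏ X_i` of feasible profiles. -/
def profiles (G : StochGame n d Ω) : Set (Profile n) :=
  {x | ∀ i, x i ∈ G.X i}

/-- The expected payoff `f_i(x) = 𝔼[ψ_i(x; ξ)]`. -/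
def payoff (G : StochGame n d Ω) (i : Fin N) (x : Profile n) : ℝ :=
  ∫ ω, G.ψ i x (G.ξ ω) ∂G.P

/-- The sampled gradient `∇_{x_i} ψ_i(x; s)`. -/
def sampleGrad (G : StochGame n d Ω) (i : Fin N) (x : Profile n)
    (s : EuclideanSpace ℝ (Fin d)) : EuclideanSpace ℝ (Fin (n i)) :=
  partialGrad (fun w => G.ψ i w s) i x

/-- `x` is a Nash equilibrium: each `x_i` minimizes `f_i(·, x_{-i})` over `X_i`. -/
def IsNash (G : StochGame n d Ω) (x : Profile n) : Prop :=
  x ∈ G.profiles ∧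
    ∀ i, ∀ u ∈ G.X i, G.payoff i x ≤ G.payoff i (Function.update x i u)

/-- The objective `u ↦ f_i(u, y_{-i}) + (μ/2) ‖u - y_i‖²` of the proximal best response. -/
def proxObj (G : StochGame n d Ω) (μ : ℝ) (i : Fin N) (y : Profile n)
    (u : EuclideanSpace ℝ (Fin (n i))) : ℝ :=
  G.payoff i (Function.update y i u) + μ / 2 * ‖u - y i‖ ^ 2

/-- The proximal best response `x̂_i(y)`: the minimizer over `X_i` of the proximal objective. -/
def proxBR (G : StochGame n d Ω) (μ : ℝ) (i : Fin N) (y : Profile n) :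
    EuclideanSpace ℝ (Fin (n i)) :=
  Classical.epsilon fun z => z ∈ G.X i ∧ ∀ w ∈ G.X i, G.proxObj μ i y z ≤ G.proxObj μ i y w

/-- The standing assumptions on the game. -/
structure Regular (G : StochGame n d Ω) (M : Fin N → ℝ) : Prop where
  isProb : IsProbabilityMeasure G.P
  meas_xi : Measurable G.ξ
  compact : ∀ i, IsCompact (G.X i)
  convex : ∀ i, Convex ℝ (G.X i)
  /-- Each `f_i(·, x_{-i})` is a well-defined expectation, convex and twice continuously
  differentiable over an open set containing `X_i`. -/
  payoff_smooth : ∀ i, ∀ x ∈ G.profiles, ∃ U : Set (EuclideanSpace ℝ (Fin (n i))),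
    IsOpen U ∧ G.X i ⊆ U ∧
    (∀ u ∈ U, Integrable (fun ω => G.ψ i (Function.update x i u) (G.ξ ω)) G.P) ∧
    ConvexOn ℝ U (fun u => G.payoff i (Function.update x i u)) ∧
    ContDiffOn ℝ 2 (fun u => G.payoff i (Function.update x i u)) U
  /-- Each `ψ_i(·, x_{-i}; ξ(ω))` is differentiable over an open set containing `X_i`. -/
  psi_diff : ∀ i, ∀ x ∈ G.profiles, ∀ ω, ∃ U : Set (EuclideanSpace ℝ (Fin (n i))),
    IsOpen U ∧ G.X i ⊆ U ∧
    DifferentiableOn ℝ (fun u => G.ψ i (Function.update x i u) (G.ξ ω)) U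
  /-- The sampled gradient is jointly measurable on `X × ℝ^d`. -/
  grad_meas : ∀ i, Measurable fun p : G.profiles × EuclideanSpace ℝ (Fin d) =>
    G.sampleGrad i p.1 p.2
  /-- The sampled gradient is unbiased. -/
  unbiased : ∀ i, ∀ x ∈ G.profiles, Integrable (fun ω => G.sampleGrad i x (G.ξ ω)) G.P ∧
    partialGrad (G.payoff i) i x = ∫ ω, G.sampleGrad i x (G.ξ ω) ∂G.P
  /-- The sampled gradient has second moment at most `M_i ^ 2`, with `M_i > 0`. -/
  M_pos : ∀ i, 0 < M i
  second_moment : ∀ i, ∀ x ∈ G.profiles,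
    Integrable (fun ω => ‖G.sampleGrad i x (G.ξ ω)‖ ^ 2) G.P ∧
    ∫ ω, ‖G.sampleGrad i x (G.ξ ω)‖ ^ 2 ∂G.P ≤ M i ^ 2

/-- `ζ_{i,min} = inf_{x ∈ X} λ_min(∇²_{x_i} f_i(x))`. -/
def zetaMin (G : StochGame n d Ω) (i : Fin N) : ℝ :=
  sInf ((fun x => lamMin (hessBlock (G.payoff i) i i x)) '' G.profiles)

/-- `ζ_{ij,max} = sup_{x ∈ X} ‖∇²_{x_i x_j} f_i(x)‖`. -/
def zetaMax (G : StochGame n d Ω) (i j : Fin N) : ℝ :=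
  sSup ((fun x => ‖hessBlock (G.payoff i) i j x‖) '' G.profiles)

/-- The matrix `Γ`, with diagonal entries `μ / (μ + ζ_{i,min})` and off-diagonal entries
`ζ_{ij,max} / (μ + ζ_{i,min})`. -/
def Gam (G : StochGame n d Ω) (μ : ℝ) : Matrix (Fin N) (Fin N) ℝ :=
  Matrix.of fun i j => (if i = j then μ else G.zetaMax i j) / (μ + G.zetaMin i)

/-- `a = ‖Γ‖`, the spectral norm. -/
def contr (G : StochGame n d Ω) (μ : ℝ) : ℝ :=
  ‖Matrix.toEuclideanCLM (n := Fin N) (𝕜 := ℝ) (G.Gam μ)‖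

/-- `Γ` is well defined (the mixed second derivatives exist on `X`, with finite suprema), and
`‖Γ‖ < 1`. -/
structure Contractive (G : StochGame n d Ω) (μ : ℝ) : Prop where
  mixed_diff : ∀ i j, i ≠ j → ∀ x ∈ G.profiles,
    DifferentiableAt ℝ (fun u => partialGrad (G.payoff i) i (Function.update x j u)) (x j)
  mixed_bdd : ∀ i j, i ≠ j →
    BddAbove ((fun x => ‖hessBlock (G.payoff i) i j x‖) '' G.profiles)
  norm_lt_one : G.contr μ < 1

/-- The inner stochastic approximation iterates of player `i`, from the profile `y` and with
samples `s 1, s 2, …`: `saIter … t` is `z_{i,t+1}`, the result of `t` projected stochastic gradient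
steps from `z_{i,1} = y_i`, the step size of step `t` being `1 / (μ (t + 1))`. -/
def saIter (G : StochGame n d Ω) (μ : ℝ) (i : Fin N) (y : Profile n)
    (s : ℕ → EuclideanSpace ℝ (Fin d)) : ℕ → EuclideanSpace ℝ (Fin (n i))
  | 0 => y i
  | t + 1 =>
    nearestPt (G.X i)
      (saIter G μ i y s t - (1 / (μ * ((t + 1 : ℕ) + 1 : ℝ))) •
        (G.sampleGrad i (Function.update y i (saIter G μ i y s t)) (s (t + 1)) +
          μ • (saIter G μ i y s t - y i)))

/-- The synchronous scheme: `x_{i,k+1}` is the result of `j i k` inner steps of player `i` from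
`x_k`, with the samples `S i k 1, …, S i k (j i k)`. -/
def syncIter (G : StochGame n d Ω) (μ : ℝ) (j : Fin N → ℕ → ℕ) (x₀ : Ω → Profile n)
    (S : Fin N → ℕ → ℕ → Ω → EuclideanSpace ℝ (Fin d)) : ℕ → Ω → Profile n
  | 0 => x₀
  | k + 1 => fun ω i => saIter G μ i (syncIter G μ j x₀ S k ω) (fun t => S i k t ω) (j i k)

/-- The `σ`-field `ℱ_k` generated by `x₀` and all the samples used before stage `k`. -/
abbrev history (j : Fin N → ℕ → ℕ) (x₀ : Ω → Profile n)
    (S : Fin N → ℕ → ℕ → Ω → EuclideanSpace ℝ (Fin d)) (k : ℕ) : MeasurableSpace Ω :=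
  MeasurableSpace.comap x₀ inferInstance ⊔
    ⨆ (i : Fin N) (l : ℕ) (_ : l < k) (t : ℕ) (_ : 1 ≤ t ∧ t ≤ j i l),
      MeasurableSpace.comap (S i l t) inferInstance

/-- The initial profile is a random point of `X`, and each sample `ξ_{i,k}^t` that is used has the
law of `ξ` and is independent of `ℱ_k` and `ξ_{i,k}^1, …, ξ_{i,k}^{t-1}`. -/
structure Sampling (G : StochGame n d Ω) (j : Fin N → ℕ → ℕ) (x₀ : Ω → Profile n)
    (S : Fin N → ℕ → ℕ → Ω → EuclideanSpace ℝ (Fin d)) : Prop where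
  init_meas : Measurable x₀
  init_mem : ∀ ω, x₀ ω ∈ G.profiles
  meas : ∀ i k t, 1 ≤ t → t ≤ j i k → Measurable (S i k t)
  law : ∀ i k t, 1 ≤ t → t ≤ j i k → IdentDistrib (S i k t) G.ξ G.P G.P
  indep : ∀ i k t, 1 ≤ t → t ≤ j i k →
    Indep
      (history j x₀ S k ⊔ ⨆ (s : ℕ) (_ : 1 ≤ s ∧ s < t),
        MeasurableSpace.comap (S i k s) inferInstance)
      (MeasurableSpace.comap (S i k t) inferInstance) G.P

/-- `z` is an inexact proximal best response of player `i` to the random profile `y`, to accuracy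
`α`: it lies in `X_i`, and `𝔼[‖z - x̂_i(y)‖² | ℱ_k] ≤ α²` almost surely. -/
def IsInexactBR (G : StochGame n d Ω) (μ : ℝ) (ℱ : ℕ → MeasurableSpace Ω) (i : Fin N) (k : ℕ)
    (α : ℝ) (y : Ω → Profile n) (z : Ω → EuclideanSpace ℝ (Fin (n i))) : Prop :=
  (∀ ω, z ω ∈ G.X i) ∧
    Integrable (fun ω => ‖z ω - G.proxBR μ i (y ω)‖ ^ 2) G.P ∧
    ∀ᵐ ω ∂G.P, condExp (ℱ k) G.P (fun ω' => ‖z ω' - G.proxBR μ i (y ω')‖ ^ 2) ω ≤ α ^ 2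

/-- The random profile `x` is an `ε`-NE₂, with respect to the equilibrium `xs`. -/
def IsEpsNE2 (G : StochGame n d Ω) (xs : Profile n) (ε : ℝ) (x : Ω → Profile n) : Prop :=
  Integrable (fun ω => ‖distVec (x ω) xs‖) G.P ∧ ∫ ω, ‖distVec (x ω) xs‖ ∂G.P ≤ ε

/-- `Q_i = 2 M_i² / μ² + 2 D_{X_i}²`, where `D_{X_i}` is the diameter of `X_i`. -/
def Qconst (G : StochGame n d Ω) (M : Fin N → ℝ) (μ : ℝ) (i : Fin N) : ℝ :=
  2 * M i ^ 2 / μ ^ 2 + 2 * Metric.diam (G.X i) ^ 2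

/-- The number `j_{i,k} = ⌈Q_i / η^{2(k+1)}⌉` of inner steps of player `i` at stage `k`. -/
def innerSteps (G : StochGame n d Ω) (M : Fin N → ℝ) (μ η : ℝ) (i : Fin N) (k : ℕ) : ℕ :=
  ⌈G.Qconst M μ i / η ^ (2 * (k + 1))⌉₊

end StochGame

/-- The explicit bound
`Q / (η⁴ ln(1/η²)) * (√N (C + η/(η-a)) / ε)² + ⌈ln((√N/ε) (C + η/(η-a))) / ln(1/η)⌉₊`,
where `⌈r⌉₊ = max (⌈r⌉, 0)`. -/
def stepBound (Q η a C : ℝ) (N : ℕ) (ε : ℝ) : ℝ :=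
  Q / (η ^ 4 * Real.log (1 / η ^ 2)) * (√(N : ℝ) * (C + η / (η - a)) / ε) ^ 2 +
    (⌈Real.log (√(N : ℝ) / ε * (C + η / (η - a))) / Real.log (1 / η)⌉₊ : ℝ)

end

/-! Equilibrium and contraction. Convexity makes the own-block Hessians positive semidefinite, so
every `zetaMin` is nonnegative and the proximal problems are strongly convex. Adding the optimality
inequalities of the proximal problems at two profiles `x`, `y` bounds the distance of the two best
responses of player `i` by row `i` of `Γ` applied to `distVec x y`. Hence the best-response map
contracts the distance vector by `a = ‖Γ‖ < 1`; its fixed points are exactly the Nash equilibria,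
and Banach's theorem gives existence and uniqueness.

Inner loop. Given the past, each stage is projected stochastic gradient descent on a `μ`-strongly
convex objective. The error `e_t` satisfies `e_{t+1} ≤ (1 - 2γμ) e_t + (γμ)² Q`, and step sizes
`1/(μ(t+1))` turn this into `e_t ≤ Q/t`, so about `Q/η^{2(k+1)}` steps reach squared accuracy
`η^{2(k+1)}`. Conditioning is done by integrating over events `A` of the past: on such an event the
new sample can be integrated out against its own law while the current iterate is frozen
(`setIntegral_comp_prodMk_of_indep`).

Outer loop. With `u_k` the expected norm of the distance vector to the equilibrium, the triangle
inequality through the exact best response gives `u_{k+1} ≤ √N η^{k+1} + a u_k`. As `a < η`, this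
yields `u_k ≤ √N (C + η/(η-a)) η^k`. Solving for `k` gives `K`; the steps are counted by a geometric
sum with ratio `1/η²`, whose last term has order `1/ε²` (`sum_ceil_div_pow_le`). -/

/-! ### Gradients and Hessians of convex functions -/

open Filter Topology in
theorem ConvexOn.add_inner_le_of_hasGradientAt {E : Type*} [NormedAddCommGroup E]
    [InnerProductSpace ℝ E] [CompleteSpace E] {s : Set E} {f : E → ℝ} {g x y : E}
    (hf : ConvexOn ℝ s f) (hx : x ∈ s) (hy : y ∈ s) (hg : HasGradientAt f g x) :
    f x + inner ℝ g (y - x) ≤ f y := by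
  have h1 : HasDerivAt (fun t : ℝ => f (x + t • (y - x))) (inner ℝ g (y - x)) 0 := by
    have := (hasGradientAt_iff_hasFDerivAt.1 hg).hasLineDerivAt (y - x)
    simpa [HasLineDerivAt] using this
  have h2 := h1.tendsto_slope_zero_right
  have h3 : ∀ᶠ t : ℝ in 𝓝[>] 0,
      t⁻¹ • (f (x + (0 + t) • (y - x)) - f (x + (0 : ℝ) • (y - x))) ≤ f y - f x := by
    have : ∀ᶠ t : ℝ in 𝓝[>] 0, t ∈ Set.Ioo (0 : ℝ) 1 := Ioo_mem_nhdsGT one_pos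
    filter_upwards [this] with t ht
    have h4 := hf.2 hx hy (by linarith [ht.2] : 0 ≤ 1 - t) ht.1.le (by ring)
    have h5 : (1 - t) • x + t • y = x + t • (y - x) := by module
    rw [h5] at h4
    simp only [smul_eq_mul, zero_add, zero_smul, add_zero] at h4 ⊢
    rw [inv_mul_le_iff₀ ht.1]
    linarith
  linarith [le_of_tendsto h2 h3]

theorem ConvexOn.inner_gradient_sub_nonneg {E : Type*} [NormedAddCommGroup E]
    [InnerProductSpace ℝ E] [CompleteSpace E] {s : Set E} {f : E → ℝ} {g h x y : E}
    (hf : ConvexOn ℝ s f) (hx : x ∈ s) (hy : y ∈ s) (hg : HasGradientAt f g x)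
    (hh : HasGradientAt f h y) : 0 ≤ inner ℝ (g - h) (x - y) := by
  have h1 := hf.add_inner_le_of_hasGradientAt hx hy hg
  have h2 := hf.add_inner_le_of_hasGradientAt hy hx hh
  have h3 : inner ℝ g (y - x) = - inner ℝ g (x - y) := by rw [← inner_neg_right, neg_sub]
  rw [inner_sub_left]
  linarith

-- The difference quotients of `g` along `v` pair nonnegatively with `v`. Since `U` is open, every
-- direction `v` is admissible, not only those pointing into a feasible set.
open Filter Topology in
theorem inner_nonneg_of_hasFDerivAt_of_monotone {E : Type*} [NormedAddCommGroup E]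
    [InnerProductSpace ℝ E] {U : Set E} (hU : IsOpen U) {g : E → E} {A : E →L[ℝ] E} {x : E}
    (hx : x ∈ U) (hg : ∀ u ∈ U, 0 ≤ inner ℝ (g u - g x) (u - x)) (hA : HasFDerivAt g A x) (v : E) :
    0 ≤ inner ℝ (A v) v := by
  have h1 : HasDerivAt (fun t : ℝ => g (x + t • v)) (A v) 0 := hA.hasLineDerivAt v
  have h2 := h1.tendsto_slope_zero_right.inner (𝕜 := ℝ) (tendsto_const_nhds (x := v))
  refine ge_of_tendsto h2 ?_
  have hc : Tendsto (fun t : ℝ => x + t • v) (𝓝[>] 0) (𝓝 x) := by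
    have : Continuous fun t : ℝ => x + t • v := by fun_prop
    simpa using (this.tendsto 0).mono_left nhdsWithin_le_nhds
  filter_upwards [hc (hU.mem_nhds hx), self_mem_nhdsWithin] with t ht ht0
  have ht0 : 0 < t := ht0
  have h3 := hg _ ht
  simp only [add_sub_cancel_left, inner_smul_right] at h3
  simp only [zero_add, zero_smul, add_zero, real_inner_smul_left]
  exact mul_nonneg (inv_nonneg.2 ht0.le) (nonneg_of_mul_nonneg_right h3 ht0)

theorem differentiableAt_gradient_of_contDiffAt {E : Type*} [NormedAddCommGroup E]
    [InnerProductSpace ℝ E] [CompleteSpace E] {f : E → ℝ} {x : E} (hf : ContDiffAt ℝ 2 f x) :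
    DifferentiableAt ℝ (gradient f) x := by
  have h1 : DifferentiableAt ℝ (fderiv ℝ f) x :=
    (hf.fderiv_right (m := 1) (by norm_num)).differentiableAt (by norm_num)
  exact ((InnerProductSpace.toDual ℝ E).symm.differentiableAt).comp x h1

theorem inner_fderiv_gradient_of_contDiffAt {E : Type*} [NormedAddCommGroup E]
    [InnerProductSpace ℝ E] [CompleteSpace E] {f : E → ℝ} {x : E} (hf : ContDiffAt ℝ 2 f x)
    (v w : E) : inner ℝ (fderiv ℝ (gradient f) x v) w = fderiv ℝ (fderiv ℝ f) x v w := by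
  have h1 : DifferentiableAt ℝ (fderiv ℝ f) x :=
    (hf.fderiv_right (m := 1) (by norm_num)).differentiableAt (by norm_num)
  have h2 : HasFDerivAt (gradient f) _ x :=
    ((InnerProductSpace.toDual ℝ E).symm.hasFDerivAt).comp x h1.hasFDerivAt
  rw [h2.fderiv]
  exact InnerProductSpace.toDual_symm_apply

theorem isSymmetric_fderiv_gradient_of_contDiffAt {E : Type*} [NormedAddCommGroup E]
    [InnerProductSpace ℝ E] [CompleteSpace E] {f : E → ℝ} {x : E} (hf : ContDiffAt ℝ 2 f x) :
    (fderiv ℝ (gradient f) x : E →ₗ[ℝ] E).IsSymmetric := by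
  intro v w
  simp only [ContinuousLinearMap.coe_coe]
  rw [real_inner_comm (fderiv ℝ (gradient f) x w) v, inner_fderiv_gradient_of_contDiffAt hf,
    inner_fderiv_gradient_of_contDiffAt hf]
  exact (hf.isSymmSndFDerivAt (by simp)).eq v w

theorem eigenvalue_nonneg_of_inner_nonneg {m : ℕ}
    {A : EuclideanSpace ℝ (Fin m) →L[ℝ] EuclideanSpace ℝ (Fin m)}
    (hp : ∀ v, 0 ≤ inner ℝ (A v) v) {l : ℝ}
    (hl : Module.End.HasEigenvalue
      (A : EuclideanSpace ℝ (Fin m) →ₗ[ℝ] EuclideanSpace ℝ (Fin m)) l) : 0 ≤ l := by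
  obtain ⟨v, hv⟩ := hl.exists_hasEigenvector
  have h1 := hp v
  have h2 : A v = l • v := hv.apply_eq_smul
  rw [h2, real_inner_smul_left, real_inner_self_eq_norm_sq] at h1
  have : 0 < ‖v‖ ^ 2 := by have := norm_pos_iff.2 hv.2; positivity
  exact nonneg_of_mul_nonneg_left h1 this

/-- In dimension `0` there is no eigenvalue and the infimum takes the default value `0`, so the
bound survives. -/
theorem lamMin_nonneg {m : ℕ} {A : EuclideanSpace ℝ (Fin m) →L[ℝ] EuclideanSpace ℝ (Fin m)}
    (hp : ∀ v, 0 ≤ inner ℝ (A v) v) : 0 ≤ lamMin A :=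
  Real.sInf_nonneg fun _ hl => eigenvalue_nonneg_of_inner_nonneg hp hl

/-- The infimum of the Rayleigh quotient of a symmetric operator is itself an eigenvalue, so
`lamMin` lies below every Rayleigh quotient. -/
theorem lamMin_mul_le {m : ℕ} {A : EuclideanSpace ℝ (Fin m) →L[ℝ] EuclideanSpace ℝ (Fin m)}
    (hs : (A : EuclideanSpace ℝ (Fin m) →ₗ[ℝ] EuclideanSpace ℝ (Fin m)).IsSymmetric)
    (hp : ∀ v, 0 ≤ inner ℝ (A v) v) (v : EuclideanSpace ℝ (Fin m)) :
    lamMin A * ‖v‖ ^ 2 ≤ inner ℝ (A v) v := by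
  rcases eq_or_ne v 0 with rfl | hv
  · simp
  have : Nontrivial (EuclideanSpace ℝ (Fin m)) := ⟨v, 0, hv⟩
  have h1 := hs.hasEigenvalue_iInf_of_finiteDimensional
  have h2 : lamMin A ≤ _ := csInf_le ⟨0, fun _ hl => eigenvalue_nonneg_of_inner_nonneg hp hl⟩ h1
  have hpos : 0 < ‖v‖ ^ 2 := by have := norm_pos_iff.2 hv; positivity
  have h3 : lamMin A ≤ inner ℝ (A v) v / ‖v‖ ^ 2 := by
    refine h2.trans ?_
    refine ciInf_le (f := fun x : { x : EuclideanSpace ℝ (Fin m) // x ≠ 0 } =>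
      inner ℝ (A (x : EuclideanSpace ℝ (Fin m))) x / ‖(x : EuclideanSpace ℝ (Fin m))‖ ^ 2)
      ⟨0, ?_⟩ ⟨v, hv⟩
    rintro _ ⟨x, rfl⟩
    exact div_nonneg (hp _) (by positivity)
  exact (le_div_iff₀ hpos).1 h3

/-- Mean value theorem for `t ↦ ⟪g (v + t (u - v)), u - v⟫` on `[0, 1]`. -/
theorem Convex.mul_norm_sq_le_inner_sub {E : Type*} [NormedAddCommGroup E]
    [InnerProductSpace ℝ E] {K : Set E} (hK : Convex ℝ K) {g : E → E} {A : E → E →L[ℝ] E} {c : ℝ}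
    (hg : ∀ x ∈ K, HasFDerivAt g (A x) x) (hA : ∀ x ∈ K, ∀ v, c * ‖v‖ ^ 2 ≤ inner ℝ (A x v) v)
    {u v : E} (hu : u ∈ K) (hv : v ∈ K) : c * ‖u - v‖ ^ 2 ≤ inner ℝ (g u - g v) (u - v) := by
  have hmem : ∀ t ∈ Set.Icc (0 : ℝ) 1, v + t • (u - v) ∈ K := fun t ht =>
    hK.add_smul_sub_mem hv hu ht
  have hd : ∀ t ∈ Set.Icc (0 : ℝ) 1, HasDerivAt (fun t : ℝ => inner ℝ (g (v + t • (u - v))) (u - v))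
      (inner ℝ (A (v + t • (u - v)) (u - v)) (u - v)) t := by
    intro t ht
    have h1 : HasDerivAt (fun t : ℝ => v + t • (u - v)) (u - v) t := by
      simpa using ((hasDerivAt_id t).smul_const (u - v)).const_add v
    have h2 := (hg _ (hmem t ht)).comp_hasDerivAt t h1
    simpa using h2.inner ℝ (hasDerivAt_const t (u - v))
  obtain ⟨t, ht, h⟩ := exists_hasDerivAt_eq_slope _ _ one_pos
    (fun t ht => (hd t ht).continuousAt.continuousWithinAt)
    (fun t ht => hd t (Set.Ioo_subset_Icc_self ht))
  have h1 := hA _ (hmem t (Set.Ioo_subset_Icc_self ht)) (u - v)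
  rw [h] at h1
  simpa [inner_sub_left] using h1

/-! ### Projection onto a compact convex set -/

section NearestPt

variable {m : ℕ} {K : Set (EuclideanSpace ℝ (Fin m))}

theorem nearestPt_spec (hK : IsCompact K) (hne : K.Nonempty) (u : EuclideanSpace ℝ (Fin m)) :
    nearestPt K u ∈ K ∧ ∀ w ∈ K, ‖u - nearestPt K u‖ ≤ ‖u - w‖ := by
  apply Classical.epsilon_spec (p := fun z => z ∈ K ∧ ∀ w ∈ K, ‖u - z‖ ≤ ‖u - w‖)
  obtain ⟨z, hz, h⟩ := hK.exists_isMinOn hne (f := fun w => ‖u - w‖) (by fun_prop)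
  exact ⟨z, hz, fun w hw => h hw⟩

theorem inner_sub_nearestPt_le (hK : IsCompact K) (hc : Convex ℝ K) (hne : K.Nonempty)
    (u : EuclideanSpace ℝ (Fin m)) {w : EuclideanSpace ℝ (Fin m)} (hw : w ∈ K) :
    inner ℝ (u - nearestPt K u) (w - nearestPt K u) ≤ 0 := by
  obtain ⟨h1, h2⟩ := nearestPt_spec hK hne u
  refine (norm_eq_iInf_iff_real_inner_le_zero hc h1).1 ?_ w hw
  have : Nonempty K := ⟨⟨_, h1⟩⟩
  refine le_antisymm (le_ciInf fun w => h2 w w.2) ?_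
  exact ciInf_le ⟨0, by rintro _ ⟨x, rfl⟩; positivity⟩ (⟨_, h1⟩ : K)

/-- Add the variational inequalities of the two projections and apply Cauchy–Schwarz. -/
theorem norm_nearestPt_sub_le (hK : IsCompact K) (hc : Convex ℝ K) (hne : K.Nonempty)
    (u v : EuclideanSpace ℝ (Fin m)) : ‖nearestPt K u - nearestPt K v‖ ≤ ‖u - v‖ := by
  have h1 := inner_sub_nearestPt_le hK hc hne u (nearestPt_spec hK hne v).1
  have h2 := inner_sub_nearestPt_le hK hc hne v (nearestPt_spec hK hne u).1
  set p := nearestPt K u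
  set q := nearestPt K v
  have h3 : ‖p - q‖ ^ 2 ≤ inner ℝ (u - v) (p - q) := by
    rw [← real_inner_self_eq_norm_sq]
    have e : inner ℝ (u - v) (p - q) - inner ℝ (p - q) (p - q)
        = - inner ℝ (u - p) (q - p) - inner ℝ (v - q) (p - q) := by
      simp only [inner_sub_left, inner_sub_right]; ring
    linarith
  have h4 := h3.trans (real_inner_le_norm _ _)
  rw [pow_two] at h4
  by_contra! h
  have h5 : 0 < ‖p - q‖ := (norm_nonneg _).trans_lt h
  nlinarith

theorem nearestPt_of_mem (hK : IsCompact K) {u : EuclideanSpace ℝ (Fin m)} (hu : u ∈ K) :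
    nearestPt K u = u := by
  have h := (nearestPt_spec hK ⟨u, hu⟩ u).2 u hu
  rw [sub_self, norm_zero, norm_le_zero_iff, sub_eq_zero] at h
  exact h.symm

theorem continuous_nearestPt (hK : IsCompact K) (hc : Convex ℝ K) (hne : K.Nonempty) :
    Continuous (nearestPt K) :=
  (LipschitzWith.of_dist_le_mul (K := 1) fun u v => by
    simpa [dist_eq_norm] using norm_nearestPt_sub_le hK hc hne u v).continuous

end NearestPt

theorem partialGrad_update {N : ℕ} {n : Fin N → ℕ} (h : Profile n → ℝ) (i : Fin N) (x : Profile n)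
    (u : EuclideanSpace ℝ (Fin (n i))) : partialGrad h i (Function.update x i u) =
      gradient (fun v => h (Function.update x i v)) u := by
  simp [partialGrad]

/-! ### Curvature and cross-Lipschitz bounds for the payoffs -/

namespace StochGame

variable {N : ℕ} {n : Fin N → ℕ} {d : ℕ} {Ω : Type*} [MeasurableSpace Ω]
  {G : StochGame n d Ω} {M : Fin N → ℝ} {μ : ℝ} {i j : Fin N} {x y z : Profile n}

theorem update_mem_profiles (hy : y ∈ G.profiles) {u : EuclideanSpace ℝ (Fin (n i))}
    (hu : u ∈ G.X i) : Function.update y i u ∈ G.profiles := by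
  intro j
  rcases eq_or_ne j i with rfl | h
  · simpa using hu
  · simpa [h] using hy j

theorem Regular.contDiffAt_payoff (hG : G.Regular M) (hy : y ∈ G.profiles)
    {u : EuclideanSpace ℝ (Fin (n i))} (hu : u ∈ G.X i) :
    ContDiffAt ℝ 2 (fun v => G.payoff i (Function.update y i v)) u := by
  obtain ⟨U, hU, hXU, -, -, h⟩ := hG.payoff_smooth i y hy
  exact h.contDiffAt (hU.mem_nhds (hXU hu))

theorem Regular.hasGradientAt_payoff (hG : G.Regular M) (hy : y ∈ G.profiles)
    {u : EuclideanSpace ℝ (Fin (n i))} (hu : u ∈ G.X i) :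
    HasGradientAt (fun v => G.payoff i (Function.update y i v))
      (partialGrad (G.payoff i) i (Function.update y i u)) u := by
  rw [partialGrad_update]
  exact ((hG.contDiffAt_payoff hy hu).differentiableAt (by norm_num)).hasGradientAt

theorem hessBlock_update (y : Profile n) (u : EuclideanSpace ℝ (Fin (n i))) :
    hessBlock (G.payoff i) i i (Function.update y i u) =
      fderiv ℝ (gradient fun v => G.payoff i (Function.update y i v)) u := by
  simp only [hessBlock, Function.update_idem, Function.update_self]
  congr 1
  ext1 v
  exact partialGrad_update _ _ _ _

theorem Regular.hasFDerivAt_partialGrad (hG : G.Regular M) (hy : y ∈ G.profiles)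
    {u : EuclideanSpace ℝ (Fin (n i))} (hu : u ∈ G.X i) :
    HasFDerivAt (fun v => partialGrad (G.payoff i) i (Function.update y i v))
      (hessBlock (G.payoff i) i i (Function.update y i u)) u := by
  rw [hessBlock_update]
  simp only [partialGrad_update]
  exact (differentiableAt_gradient_of_contDiffAt (hG.contDiffAt_payoff hy hu)).hasFDerivAt

theorem Regular.isSymmetric_hessBlock (hG : G.Regular M) (hx : x ∈ G.profiles) :
    (hessBlock (G.payoff i) i i x :
      EuclideanSpace ℝ (Fin (n i)) →ₗ[ℝ] EuclideanSpace ℝ (Fin (n i))).IsSymmetric := by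
  have h := isSymmetric_fderiv_gradient_of_contDiffAt (hG.contDiffAt_payoff hx (hx i))
  rwa [← hessBlock_update, Function.update_eq_self] at h

/-- Convexity on the open neighbourhood `U` is essential: `X_i` may have empty interior, and
convexity on it alone would not control all directions. -/
theorem Regular.inner_hessBlock_nonneg (hG : G.Regular M) (hx : x ∈ G.profiles)
    (v : EuclideanSpace ℝ (Fin (n i))) : 0 ≤ inner ℝ (hessBlock (G.payoff i) i i x v) v := by
  obtain ⟨U, hU, hXU, -, hc, hs⟩ := hG.payoff_smooth i x hx
  have h := hG.hasFDerivAt_partialGrad hx (hx i)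
  rw [Function.update_eq_self] at h
  refine inner_nonneg_of_hasFDerivAt_of_monotone hU (hXU (hx i)) (fun u hu => ?_) h v
  have hd : ∀ w ∈ U, HasGradientAt (fun v => G.payoff i (Function.update x i v))
      (partialGrad (G.payoff i) i (Function.update x i w)) w := fun w hw => by
    rw [partialGrad_update]
    exact ((hs.contDiffAt (hU.mem_nhds hw)).differentiableAt (by norm_num)).hasGradientAt
  exact hc.inner_gradient_sub_nonneg hu (hXU (hx i)) (hd u hu) (hd _ (hXU (hx i)))

theorem Regular.zetaMin_nonneg (hG : G.Regular M) : 0 ≤ G.zetaMin i := by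
  apply Real.sInf_nonneg
  rintro _ ⟨x, hx, rfl⟩
  exact lamMin_nonneg (hG.inner_hessBlock_nonneg hx)

theorem Regular.zetaMin_mul_le (hG : G.Regular M) (hx : x ∈ G.profiles)
    (v : EuclideanSpace ℝ (Fin (n i))) :
    G.zetaMin i * ‖v‖ ^ 2 ≤ inner ℝ (hessBlock (G.payoff i) i i x v) v := by
  refine le_trans ?_ (lamMin_mul_le (hG.isSymmetric_hessBlock hx) (hG.inner_hessBlock_nonneg hx) v)
  gcongr
  refine csInf_le ⟨0, ?_⟩ ⟨x, hx, rfl⟩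
  rintro _ ⟨x, hx, rfl⟩
  exact lamMin_nonneg (hG.inner_hessBlock_nonneg hx)

theorem Regular.zetaMin_mul_norm_sq_le (hG : G.Regular M) (hy : y ∈ G.profiles)
    {u v : EuclideanSpace ℝ (Fin (n i))} (hu : u ∈ G.X i) (hv : v ∈ G.X i) :
    G.zetaMin i * ‖u - v‖ ^ 2 ≤ inner ℝ (partialGrad (G.payoff i) i (Function.update y i u) -
      partialGrad (G.payoff i) i (Function.update y i v)) (u - v) :=
  (hG.convex i).mul_norm_sq_le_inner_sub
    (g := fun u => partialGrad (G.payoff i) i (Function.update y i u))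
    (fun _ hw => hG.hasFDerivAt_partialGrad hy hw)
    (fun _ hw => hG.zetaMin_mul_le (update_mem_profiles hy hw)) hu hv

theorem zetaMax_nonneg : 0 ≤ G.zetaMax i j := by
  apply Real.sSup_nonneg
  rintro _ ⟨x, hx, rfl⟩
  exact norm_nonneg _

theorem Contractive.norm_partialGrad_update_sub_le (hΓ : G.Contractive μ) (hG : G.Regular M)
    (hij : i ≠ j) (hy : y ∈ G.profiles) {u v : EuclideanSpace ℝ (Fin (n j))}
    (hu : u ∈ G.X j) (hv : v ∈ G.X j) :
    ‖partialGrad (G.payoff i) i (Function.update y j u) -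
      partialGrad (G.payoff i) i (Function.update y j v)‖ ≤ G.zetaMax i j * ‖u - v‖ := by
  refine (hG.convex j).norm_image_sub_le_of_norm_hasFDerivWithin_le (𝕜 := ℝ)
    (f := fun w => partialGrad (G.payoff i) i (Function.update y j w))
    (f' := fun w => hessBlock (G.payoff i) i j (Function.update y j w)) (fun w hw => ?_)
    (fun w hw => ?_) hv hu
  · have h := (hΓ.mixed_diff i j hij _ (update_mem_profiles hy hw)).hasFDerivAt
    simp only [Function.update_idem, Function.update_self] at h
    simp only [hessBlock, Function.update_idem, Function.update_self]
    exact h.hasFDerivWithinAt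
  · exact le_csSup (hΓ.mixed_bdd i j hij) ⟨_, update_mem_profiles hy hw, rfl⟩

/-- Pass from `y` to `x` one coordinate at a time. The intermediate profiles stay feasible because
the feasible set is a product. -/
theorem Contractive.norm_partialGrad_sub_le (hΓ : G.Contractive μ) (hG : G.Regular M)
    (hx : x ∈ G.profiles) (hy : y ∈ G.profiles) (hxy : x i = y i) :
    ‖partialGrad (G.payoff i) i x - partialGrad (G.payoff i) i y‖ ≤
      ∑ j ∈ Finset.univ.erase i, G.zetaMax i j * ‖x j - y j‖ := by
  have key : ∀ s : Finset (Fin N), i ∉ s →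
      s.piecewise x y ∈ G.profiles ∧
      ‖partialGrad (G.payoff i) i (s.piecewise x y) - partialGrad (G.payoff i) i y‖ ≤
        ∑ j ∈ s, G.zetaMax i j * ‖x j - y j‖ := by
    intro s
    induction s using Finset.induction_on with
    | empty => intro _; simpa using hy
    | insert j s hj ih =>
      intro his
      obtain ⟨hm, hle⟩ := ih fun h => his (Finset.mem_insert_of_mem h)
      have hij : i ≠ j := fun h => his (h ▸ Finset.mem_insert_self _ _)
      rw [Finset.piecewise_insert, Finset.sum_insert hj]
      refine ⟨update_mem_profiles hm (hx j), ?_⟩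
      have h1 := hΓ.norm_partialGrad_update_sub_le hG hij hm (hx j) (hy j)
      have h2 : Function.update (s.piecewise x y) j (y j) = s.piecewise x y := by
        rw [Function.update_eq_self_iff, Finset.piecewise_eq_of_notMem _ _ _ hj]
      rw [h2] at h1
      refine (norm_sub_le_norm_sub_add_norm_sub _
        (partialGrad (G.payoff i) i (s.piecewise x y)) _).trans (add_le_add h1 hle)
  have h := (key (Finset.univ.erase i) (by simp)).2
  have h2 : (Finset.univ.erase i).piecewise x y = x := by
    ext1 j
    by_cases hj : j = i
    · subst hj; simp [hxy]
    · simp [Finset.piecewise, hj]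
  rwa [h2] at h

/-! ### Proximal best responses, their contraction, and the equilibrium -/

theorem Regular.proxBR_spec (hG : G.Regular M) (μ : ℝ) (i : Fin N) (hy : y ∈ G.profiles) :
    G.proxBR μ i y ∈ G.X i ∧
      ∀ w ∈ G.X i, G.proxObj μ i y (G.proxBR μ i y) ≤ G.proxObj μ i y w := by
  apply Classical.epsilon_spec (p := fun z => z ∈ G.X i ∧
    ∀ w ∈ G.X i, G.proxObj μ i y z ≤ G.proxObj μ i y w)
  have hc : ContinuousOn (G.proxObj μ i y) (G.X i) := by
    intro u hu
    refine ContinuousAt.continuousWithinAt (ContinuousAt.add ?_ (by fun_prop))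
    exact (hG.contDiffAt_payoff hy hu).continuousAt
  obtain ⟨z, hz, h⟩ := (hG.compact i).exists_isMinOn ⟨y i, hy i⟩ hc
  exact ⟨z, hz, fun w hw => h hw⟩

/-- The first-order optimality condition of the proximal problem. -/
theorem Regular.inner_nonneg_of_proxObj_le (hG : G.Regular M) (hy : y ∈ G.profiles)
    {p w : EuclideanSpace ℝ (Fin (n i))} (hp : p ∈ G.X i)
    (hmin : ∀ w ∈ G.X i, G.proxObj μ i y p ≤ G.proxObj μ i y w) (hw : w ∈ G.X i) :
    0 ≤ inner ℝ (partialGrad (G.payoff i) i (Function.update y i p) + μ • (p - y i)) (w - p) := by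
  have h1 := hasGradientAt_iff_hasFDerivAt.1 (hG.hasGradientAt_payoff hy hp)
  have h2 : HasFDerivAt (fun u : EuclideanSpace ℝ (Fin (n i)) => μ / 2 * ‖u - y i‖ ^ 2) _ p :=
    (((hasFDerivAt_id p).sub_const (y i)).norm_sq).const_mul (μ / 2)
  have h3 : IsLocalMinOn (G.proxObj μ i y) (G.X i) p :=
    IsMinOn.localize (fun w hw => hmin w hw)
  have h4 := h3.hasFDerivWithinAt_nonneg (h1.add h2).hasFDerivWithinAt
    (sub_mem_posTangentConeAt_of_segment_subset ((hG.convex i).segment_subset hp hw))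
  simp only [add_apply, InnerProductSpace.toDual_apply_apply,
    smul_apply, ContinuousLinearMap.comp_apply, smul_eq_mul,
    innerSL_apply_apply, id] at h4
  rw [inner_add_left, real_inner_smul_left]
  convert h4 using 2
  simp only [nsmul_eq_mul, Nat.cast_ofNat, ContinuousLinearMap.id_apply]
  ring

theorem Regular.inner_proxBR_nonneg (hG : G.Regular M) (hy : y ∈ G.profiles)
    {w : EuclideanSpace ℝ (Fin (n i))} (hw : w ∈ G.X i) :
    0 ≤ inner ℝ (partialGrad (G.payoff i) i (Function.update y i (G.proxBR μ i y)) +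
      μ • (G.proxBR μ i y - y i)) (w - G.proxBR μ i y) :=
  hG.inner_nonneg_of_proxObj_le hy (hG.proxBR_spec μ i hy).1 (hG.proxBR_spec μ i hy).2 hw

/-- Stability of minimizers of proximal problems in the reference profile. -/
theorem Contractive.norm_sub_le_of_proxObj_le (hΓ : G.Contractive μ) (hG : G.Regular M)
    (hx : x ∈ G.profiles) (hy : y ∈ G.profiles) {p q : EuclideanSpace ℝ (Fin (n i))}
    (hμ : 0 < μ) (hp : p ∈ G.X i) (hpm : ∀ w ∈ G.X i, G.proxObj μ i x p ≤ G.proxObj μ i x w)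
    (hq : q ∈ G.X i) (hqm : ∀ w ∈ G.X i, G.proxObj μ i y q ≤ G.proxObj μ i y w) :
    (μ + G.zetaMin i) * ‖p - q‖ ≤
      μ * ‖x i - y i‖ + ∑ j ∈ Finset.univ.erase i, G.zetaMax i j * ‖x j - y j‖ := by
  have h1 := hG.inner_nonneg_of_proxObj_le hx hp hpm hq
  have h2 := hG.inner_nonneg_of_proxObj_le hy hq hqm hp
  have h3 := hG.zetaMin_mul_norm_sq_le hx hp hq
  have h4 := hΓ.norm_partialGrad_sub_le (i := i) hG (update_mem_profiles hx hq)
    (update_mem_profiles hy hq) (by simp)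
  have h5 : ∑ j ∈ Finset.univ.erase i, G.zetaMax i j *
      ‖Function.update x i q j - Function.update y i q j‖ =
      ∑ j ∈ Finset.univ.erase i, G.zetaMax i j * ‖x j - y j‖ := by
    refine Finset.sum_congr rfl fun j hj => ?_
    simp [Finset.ne_of_mem_erase hj]
  rw [h5] at h4
  set T := ∑ j ∈ Finset.univ.erase i, G.zetaMax i j * ‖x j - y j‖
  set a := partialGrad (G.payoff i) i (Function.update x i p)
  set b := partialGrad (G.payoff i) i (Function.update x i q)
  set c := partialGrad (G.payoff i) i (Function.update y i q)
  have h6 := neg_le_of_abs_le (abs_real_inner_le_norm (b - c) (p - q))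
  have h7 := real_inner_le_norm (x i - y i) (p - q)
  have h8 : ‖p - q‖ ^ 2 = inner ℝ (p - q) (p - q) := (real_inner_self_eq_norm_sq _).symm
  -- The sum of the two optimality inequalities, with the mixed gradient `b` inserted: `a - b`
  -- varies only the own strategy and gives curvature `zetaMin`, while `b - c` varies only the
  -- opponents and gives `T`.
  have e : inner ℝ (a + μ • (p - x i)) (q - p) + inner ℝ (c + μ • (q - y i)) (p - q) =
      - inner ℝ (a - b) (p - q) - inner ℝ (b - c) (p - q) - μ * inner ℝ (p - q) (p - q)
        + μ * inner ℝ (x i - y i) (p - q) := by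
    simp only [inner_add_left, inner_sub_left, inner_sub_right, real_inner_smul_left]; ring
  have h9 : (μ + G.zetaMin i) * ‖p - q‖ * ‖p - q‖ ≤ (μ * ‖x i - y i‖ + T) * ‖p - q‖ := by
    have h10 : ‖b - c‖ * ‖p - q‖ ≤ T * ‖p - q‖ := by gcongr
    have h11 := mul_le_mul_of_nonneg_left h7 hμ.le
    nlinarith
  rcases (norm_nonneg (p - q)).eq_or_lt with h | h
  · rw [← h, mul_zero]
    exact add_nonneg (by positivity)
      (Finset.sum_nonneg fun j _ => mul_nonneg zetaMax_nonneg (norm_nonneg _))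
  · exact le_of_mul_le_mul_right h9 h

/-- Stability with equal reference profiles is uniqueness of the minimizer. -/
theorem Contractive.eq_proxBR (hΓ : G.Contractive μ) (hG : G.Regular M) (hμ : 0 < μ)
    (hy : y ∈ G.profiles) {p : EuclideanSpace ℝ (Fin (n i))} (hp : p ∈ G.X i)
    (hpm : ∀ w ∈ G.X i, G.proxObj μ i y p ≤ G.proxObj μ i y w) : p = G.proxBR μ i y := by
  have h := hΓ.norm_sub_le_of_proxObj_le hG hy hy hμ hp hpm (hG.proxBR_spec μ i hy).1
    (hG.proxBR_spec μ i hy).2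
  simp only [sub_self, norm_zero, mul_zero, Finset.sum_const_zero, add_zero] at h
  have h0 := hG.zetaMin_nonneg (i := i)
  have h1 : ‖p - G.proxBR μ i y‖ ≤ 0 := nonpos_of_mul_nonpos_right h (by linarith)
  exact sub_eq_zero.1 (norm_le_zero_iff.1 h1)

theorem contr_nonneg : 0 ≤ G.contr μ := norm_nonneg _

/-- Dividing the stability estimate by `μ + zetaMin` bounds each entry by that of `Γ` applied to the
distance vector; the operator norm does the rest. -/
theorem Contractive.norm_distVec_proxBR_le (hΓ : G.Contractive μ) (hG : G.Regular M) (hμ : 0 < μ)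
    (hx : x ∈ G.profiles) (hy : y ∈ G.profiles) :
    ‖distVec (fun i => G.proxBR μ i x) (fun i => G.proxBR μ i y)‖ ≤
      G.contr μ * ‖distVec x y‖ := by
  refine le_trans ?_ (ContinuousLinearMap.le_opNorm
    (Matrix.toEuclideanCLM (n := Fin N) (𝕜 := ℝ) (G.Gam μ)) (distVec x y))
  rw [EuclideanSpace.norm_eq, EuclideanSpace.norm_eq]
  refine Real.sqrt_le_sqrt (Finset.sum_le_sum fun i _ => ?_)
  refine pow_le_pow_left₀ (norm_nonneg _) ?_ 2
  have h0 := hG.zetaMin_nonneg (i := i)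
  have h1 := hΓ.norm_sub_le_of_proxObj_le hG hx hy hμ (hG.proxBR_spec μ i hx).1
    (hG.proxBR_spec μ i hx).2 (hG.proxBR_spec μ i hy).1 (hG.proxBR_spec μ i hy).2
  have h2 : (Matrix.toEuclideanCLM (n := Fin N) (𝕜 := ℝ) (G.Gam μ)) (distVec x y) i =
      (μ * ‖x i - y i‖ + ∑ j ∈ Finset.univ.erase i, G.zetaMax i j * ‖x j - y j‖) /
        (μ + G.zetaMin i) := by
    rw [distVec, Matrix.toEuclideanCLM_toLp]
    simp only [Matrix.mulVec, dotProduct, Gam, Matrix.of_apply]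
    rw [← Finset.add_sum_erase _ _ (Finset.mem_univ i), add_div, Finset.sum_div]
    congr 1
    · rw [if_pos rfl]; ring
    · refine Finset.sum_congr rfl fun j hj => ?_
      rw [if_neg (Finset.ne_of_mem_erase hj).symm]; ring
  rw [h2]
  refine le_trans ?_ (Real.le_norm_self _)
  rw [le_div_iff₀ (by linarith)]
  simpa [distVec, mul_comm] using h1

/-- The proximal penalty and its gradient both vanish at `u = x i`. So an equilibrium strategy still
minimizes the penalized objective, and at a fixed point the optimality condition is that of `f_i`
alone, which suffices by convexity. -/
theorem isNash_iff_proxBR (hG : G.Regular M) (hΓ : G.Contractive μ) (hμ : 0 < μ) :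
    G.IsNash x ↔ x ∈ G.profiles ∧ (fun i => G.proxBR μ i x) = x := by
  constructor
  · rintro ⟨hx, h⟩
    refine ⟨hx, funext fun i => (hΓ.eq_proxBR hG hμ hx (hx i) fun w hw => ?_).symm⟩
    have h1 := h i w hw
    simp only [proxObj, Function.update_eq_self, sub_self, norm_zero]
    have : 0 ≤ μ / 2 * ‖w - x i‖ ^ 2 := by positivity
    linarith
  · rintro ⟨hx, h⟩
    refine ⟨hx, fun i u hu => ?_⟩
    have hi : G.proxBR μ i x = x i := congrFun h i
    have h1 := hG.inner_proxBR_nonneg (μ := μ) hx hu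
    rw [hi, sub_self, smul_zero, add_zero, Function.update_eq_self] at h1
    obtain ⟨U, hU, hXU, -, hc, -⟩ := hG.payoff_smooth i x hx
    have h2 := hc.add_inner_le_of_hasGradientAt (hXU (hx i)) (hXU hu)
      (hG.hasGradientAt_payoff hx (hx i))
    simp only [Function.update_eq_self] at h2
    linarith

/-- Identifies the distance vector's norm with the metric of a complete `ℓ²` product, where Banach's
theorem applies. -/
theorem norm_distVec_eq (x y : Profile n) :
    ‖distVec x y‖ = dist (WithLp.toLp 2 x : PiLp 2 fun i => EuclideanSpace ℝ (Fin (n i)))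
      (WithLp.toLp 2 y) := by
  rw [EuclideanSpace.norm_eq, dist_eq_norm, PiLp.norm_eq_of_L2]
  simp [distVec]

theorem existsUnique_isNash (hG : G.Regular M) (hΓ : G.Contractive μ) (hμ : 0 < μ)
    (hne : G.profiles.Nonempty) : ∃! x : Profile n, G.IsNash x := by
  obtain ⟨x₀, hx₀⟩ := hne
  let s : Set (PiLp 2 fun i => EuclideanSpace ℝ (Fin (n i))) := {x | WithLp.ofLp x ∈ G.profiles}
  let f : PiLp 2 (fun i => EuclideanSpace ℝ (Fin (n i))) →
      PiLp 2 fun i => EuclideanSpace ℝ (Fin (n i)) := fun x => WithLp.toLp 2 fun i => G.proxBR μ i (WithLp.ofLp x)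
  have hs : IsComplete s := by
    refine IsClosed.isComplete ?_
    have : s = ⋂ i, {x : PiLp 2 fun i => EuclideanSpace ℝ (Fin (n i)) | x i ∈ G.X i} := by ext x; simp [s, profiles]
    rw [this]
    exact isClosed_iInter fun i => (hG.compact i).isClosed.preimage (by fun_prop)
  have hf : Set.MapsTo f s s := fun x hx i => (hG.proxBR_spec μ i hx).1
  have hcon : ContractingWith ⟨G.contr μ, contr_nonneg⟩ (hf.restrict f s s) := by
    refine ⟨hΓ.norm_lt_one, LipschitzWith.of_dist_le_mul fun x y => ?_⟩
    have h := hΓ.norm_distVec_proxBR_le hG hμ x.2 y.2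
    rw [norm_distVec_eq, norm_distVec_eq] at h
    exact h
  obtain ⟨y, hy, hfy, -⟩ := hcon.exists_fixedPoint' hs hf (x := WithLp.toLp 2 x₀) hx₀
    (edist_ne_top _ _)
  refine ⟨WithLp.ofLp y, (isNash_iff_proxBR hG hΓ hμ).2 ⟨hy, congrArg WithLp.ofLp hfy⟩, ?_⟩
  intro z hz
  obtain ⟨hz, hfz⟩ := (isNash_iff_proxBR hG hΓ hμ).1 hz
  have h := hΓ.norm_distVec_proxBR_le hG hμ hz hy
  rw [hfz, show (fun i => G.proxBR μ i (WithLp.ofLp y)) = WithLp.ofLp y from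
    congrArg WithLp.ofLp hfy, norm_distVec_eq] at h
  have h1 := hΓ.norm_lt_one
  have h2 : dist (WithLp.toLp 2 z : PiLp 2 fun i => EuclideanSpace ℝ (Fin (n i)))
       (WithLp.toLp 2 (WithLp.ofLp y)) = 0 := by
    by_contra hd
    have := dist_nonneg.lt_of_ne' hd
    nlinarith
  exact congrArg WithLp.ofLp (dist_eq_zero.1 h2)

end StochGame

/-! ### Integrating out an independent sample -/

/-- Restricting to an event `A` of `H` keeps `S` independent of `Z`, so `(Z, S)` has a product law
under the restricted measure and Fubini applies. -/
theorem setIntegral_comp_prodMk_of_indep {Ω α β : Type*} {H m₀ : MeasurableSpace Ω}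
    [MeasurableSpace α] [MeasurableSpace β] {P : Measure Ω} [IsProbabilityMeasure P]
    (hH : H ≤ m₀) {Z : Ω → α} {S : Ω → β} (hZ : Measurable[H] Z)
    (hS : Measurable S) (hind : Indep H (MeasurableSpace.comap S inferInstance) P)
    {A : Set Ω} (hA : MeasurableSet[H] A) {φ : α × β → ℝ} (hφ : Measurable φ) {C : ℝ}
    (hC : ∀ p, |φ p| ≤ C) :
    ∫ ω in A, φ (Z ω, S ω) ∂P = ∫ ω in A, ∫ s, φ (Z ω, s) ∂(P.map S) ∂P := by
  have hZ' : Measurable Z := hZ.mono hH le_rfl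
  have : IsProbabilityMeasure (P.map S) := Measure.isProbabilityMeasure_map hS.aemeasurable
  have hlaw : (P.restrict A).map (fun ω => (Z ω, S ω)) =
      ((P.restrict A).map Z).prod (P.map S) := by
    symm
    apply Measure.prod_eq
    intro s t hs ht
    rw [Measure.map_apply (hZ'.prodMk hS) (hs.prod ht), Measure.map_apply hZ' hs,
      Measure.map_apply hS ht, Measure.restrict_apply ((hZ'.prodMk hS) (hs.prod ht)),
      Measure.restrict_apply (hZ' hs)]
    have h := (Indep_iff _ _ _).1 hind (Z ⁻¹' s ∩ A) (S ⁻¹' t)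
      (MeasurableSet.inter (hZ hs) hA) ⟨t, ht, rfl⟩
    rw [← h]
    congr 1
    ext ω
    simp only [Set.mem_inter_iff, Set.mem_preimage, Set.mem_prod]
    tauto
  have hint : Integrable φ (((P.restrict A).map Z).prod (P.map S)) :=
    Integrable.of_bound hφ.aestronglyMeasurable C (.of_forall fun p => by simpa using hC p)
  calc ∫ ω in A, φ (Z ω, S ω) ∂P
      = ∫ p, φ p ∂((P.restrict A).map fun ω => (Z ω, S ω)) :=
        (integral_map (hZ'.prodMk hS).aemeasurable hφ.aestronglyMeasurable).symm
    _ = ∫ z, ∫ s, φ (z, s) ∂(P.map S) ∂((P.restrict A).map Z) := by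
        rw [hlaw, integral_prod _ hint]
    _ = _ := integral_map hZ'.aemeasurable
        (hφ.stronglyMeasurable.integral_prod_right' (ν := P.map S)).aestronglyMeasurable

/-- Compare integrals over `H`-events in the trimmed measure, where the conditional expectation is
an honest measurable function. -/
theorem condExp_le_of_forall_setIntegral_le {Ω : Type*} {H m₀ : MeasurableSpace Ω} {P : Measure Ω}
    [IsProbabilityMeasure P] (hH : H ≤ m₀) {f : Ω → ℝ}
    (hf : Integrable f P) {c : ℝ}
    (h : ∀ A, MeasurableSet[H] A → ∫ ω in A, f ω ∂P ≤ c * P.real A) :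
    ∀ᵐ ω ∂P, condExp H P f ω ≤ c := by
  refine ae_le_of_ae_le_trim (hm := hH) ?_
  refine ae_le_of_forall_setIntegral_le
    (integrable_condExp.trim hH stronglyMeasurable_condExp) (integrable_const c) ?_
  intro A hA _
  rw [← setIntegral_trim hH stronglyMeasurable_condExp hA, setIntegral_condExp hH hf hA,
    setIntegral_const, smul_eq_mul, mul_comm]
  refine (h A hA).trans_eq ?_
  rw [measureReal_def, measureReal_def, trim_measurableSet_eq hH hA]

/-! ### One stochastic gradient step: measurability and progress -/

namespace StochGame

variable {N : ℕ} {n : Fin N → ℕ} {d : ℕ} {Ω : Type*} [MeasurableSpace Ω]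
  {G : StochGame n d Ω} {M : Fin N → ℝ} {μ : ℝ} {i : Fin N} {x y z : Profile n}

/-- One projected stochastic gradient step of player `i`, with step size `γ` and sample `s`. -/
noncomputable def saStep (G : StochGame n d Ω) (μ : ℝ) (i : Fin N) (γ : ℝ) (y : Profile n)
    (z : EuclideanSpace ℝ (Fin (n i))) (s : EuclideanSpace ℝ (Fin d)) :
    EuclideanSpace ℝ (Fin (n i)) :=
  nearestPt (G.X i) (z - γ • (G.sampleGrad i (Function.update y i z) s + μ • (z - y i)))

theorem saIter_succ (y : Profile n) (s : ℕ → EuclideanSpace ℝ (Fin d)) (t : ℕ) :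
    G.saIter μ i y s (t + 1) =
      G.saStep μ i (1 / (μ * ((t + 1 : ℕ) + 1 : ℝ))) y (G.saIter μ i y s t) (s (t + 1)) := rfl

theorem Regular.saStep_mem (hG : G.Regular M) (hy : y ∈ G.profiles) (γ : ℝ)
    (z : EuclideanSpace ℝ (Fin (n i))) (s : EuclideanSpace ℝ (Fin d)) :
    G.saStep μ i γ y z s ∈ G.X i :=
  (nearestPt_spec (hG.compact i) ⟨_, hy i⟩ _).1

theorem Regular.saIter_mem (hG : G.Regular M) (hy : y ∈ G.profiles)
    (s : ℕ → EuclideanSpace ℝ (Fin d)) (t : ℕ) : G.saIter μ i y s t ∈ G.X i := by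
  cases t with
  | zero => exact hy i
  | succ t => rw [saIter_succ]; exact hG.saStep_mem hy _ _ _

theorem Regular.measurable_saStep (hG : G.Regular M) (hne : (G.X i).Nonempty) (γ : ℝ) :
    Measurable fun p : (G.profiles × G.X i) × EuclideanSpace ℝ (Fin d) =>
      G.saStep μ i γ p.1.1 p.1.2 p.2 := by
  refine (continuous_nearestPt (hG.compact i) (hG.convex i) hne).measurable.comp ?_
  have h1 : Measurable fun p : (G.profiles × G.X i) × EuclideanSpace ℝ (Fin d) =>
      (p.1.1 : Profile n) := by fun_prop
  have h2 : Measurable fun p : (G.profiles × G.X i) × EuclideanSpace ℝ (Fin d) =>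
      (p.1.2 : EuclideanSpace ℝ (Fin (n i))) := by fun_prop
  have h3 : Measurable fun p : (G.profiles × G.X i) × EuclideanSpace ℝ (Fin d) =>
      Function.update (p.1.1 : Profile n) i (p.1.2 : EuclideanSpace ℝ (Fin (n i))) := by
    refine measurable_pi_lambda _ fun j => ?_
    rcases eq_or_ne j i with rfl | hj
    · simpa using h2
    · simpa [hj, Function.comp_def] using (measurable_pi_apply j).comp h1
  have h4 : Measurable fun p : (G.profiles × G.X i) × EuclideanSpace ℝ (Fin d) =>
      G.sampleGrad i (Function.update (p.1.1 : Profile n) i p.1.2) p.2 :=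
    (hG.grad_meas i).comp
      ((h3.subtype_mk (h := fun p => update_mem_profiles p.1.1.2 p.1.2.2)).prodMk measurable_snd)
  exact h2.sub ((h4.add ((h2.sub ((measurable_pi_apply i).comp h1)).const_smul μ)).const_smul γ)

/-- Continuity follows from the contraction estimate, hence only on feasible profiles; it supplies
the measurability of the best response. -/
theorem Contractive.continuous_proxBR (hΓ : G.Contractive μ) (hG : G.Regular M) (hμ : 0 < μ) :
    Continuous fun y : G.profiles => G.proxBR μ i y := by
  refine continuous_iff_continuousAt.2 fun y => tendsto_iff_norm_sub_tendsto_zero.2 ?_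
  have h1 : Continuous fun x : G.profiles => G.contr μ * ‖distVec (x : Profile n) y‖ := by
    refine continuous_const.mul ((PiLp.continuous_toLp 2 _).comp ?_).norm
    exact continuous_pi fun i =>
      (((continuous_apply i).comp continuous_subtype_val).sub continuous_const).norm
  have h2 := h1.tendsto y
  have h3 : G.contr μ * ‖distVec (y : Profile n) y‖ = 0 := by
    rw [norm_distVec_eq, dist_self, mul_zero]
  rw [h3] at h2
  refine squeeze_zero (fun _ => norm_nonneg _) (fun x => ?_) h2
  refine le_trans ?_ (hΓ.norm_distVec_proxBR_le hG hμ x.2 y.2)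
  have := PiLp.norm_apply_le (distVec (fun i => G.proxBR μ i x) (fun i => G.proxBR μ i y)) i
  simpa [distVec] using this

theorem Regular.measurable_saStep_comp (hG : G.Regular M) {α : Type*} {_ : MeasurableSpace α}
    {Y : α → Profile n} (hY : Measurable Y) (hYm : ∀ ω, Y ω ∈ G.profiles)
    {z : α → EuclideanSpace ℝ (Fin (n i))} (hz : Measurable z) (hzm : ∀ ω, z ω ∈ G.X i)
    {s : α → EuclideanSpace ℝ (Fin d)} (hs : Measurable s) (γ : ℝ) :
    Measurable fun ω => G.saStep μ i γ (Y ω) (z ω) (s ω) := by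
  by_cases hne : (G.X i).Nonempty
  · have h : Measurable fun ω => (((⟨Y ω, hYm ω⟩, ⟨z ω, hzm ω⟩), s ω) :
        (G.profiles × G.X i) × EuclideanSpace ℝ (Fin d)) :=
      (hY.subtype_mk.prodMk hz.subtype_mk).prodMk hs
    have h2 := (hG.measurable_saStep (μ := μ) hne γ)
    have h3 := Measurable.comp h2 h
    exact h3
  · have : IsEmpty α := ⟨fun ω => hne ⟨_, hYm ω i⟩⟩
    exact measurable_of_empty _

/-- The `σ`-field on `α` is left free so that the ambient field, `history` and `stageHistory` can
all be used. -/
theorem Regular.measurable_saIter (hG : G.Regular M) {α : Type*} {_ : MeasurableSpace α}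
    {Y : α → Profile n} (hY : Measurable Y) (hYm : ∀ ω, Y ω ∈ G.profiles)
    {s : ℕ → α → EuclideanSpace ℝ (Fin d)} {t : ℕ}
    (hs : ∀ r, 1 ≤ r → r ≤ t → Measurable (s r)) :
    Measurable fun ω => G.saIter μ i (Y ω) (fun r => s r ω) t := by
  induction t with
  | zero => exact (measurable_pi_apply i).comp hY
  | succ t ih =>
    exact hG.measurable_saStep_comp hY hYm (ih fun r hr hrt => hs r hr (by omega))
      (fun ω => hG.saIter_mem (hYm ω) _ _) (hs (t + 1) (by omega) le_rfl)
      (1 / (μ * ((t + 1 : ℕ) + 1 : ℝ)))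

theorem Regular.norm_sub_le_diam (hG : G.Regular M) {u v : EuclideanSpace ℝ (Fin (n i))}
    (hu : u ∈ G.X i) (hv : v ∈ G.X i) : ‖u - v‖ ≤ Metric.diam (G.X i) := by
  rw [← dist_eq_norm]
  exact Metric.dist_le_diam_of_mem (hG.compact i).isBounded hu hv

/-- The proximal term alone provides the modulus `μ`; the nonnegative `zetaMin` is discarded. -/
theorem Regular.mul_norm_sq_le_inner (hG : G.Regular M) (hy : y ∈ G.profiles)
    {z : EuclideanSpace ℝ (Fin (n i))} (hz : z ∈ G.X i) :
    μ * ‖z - G.proxBR μ i y‖ ^ 2 ≤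
      inner ℝ (partialGrad (G.payoff i) i (Function.update y i z) + μ • (z - y i))
        (z - G.proxBR μ i y) := by
  have h1 := hG.inner_proxBR_nonneg (μ := μ) hy hz
  have h2 := hG.zetaMin_mul_norm_sq_le hy hz (hG.proxBR_spec μ i hy).1
  have h3 : 0 ≤ G.zetaMin i * ‖z - G.proxBR μ i y‖ ^ 2 :=
    mul_nonneg hG.zetaMin_nonneg (by positivity)
  set c := G.proxBR μ i y
  set a := partialGrad (G.payoff i) i (Function.update y i z)
  set b := partialGrad (G.payoff i) i (Function.update y i c)
  have e : inner ℝ (a + μ • (z - y i)) (z - c) = inner ℝ (a - b) (z - c) +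
      inner ℝ (b + μ • (c - y i)) (z - c) + μ * inner ℝ (z - c) (z - c) := by
    simp only [inner_add_left, inner_sub_left, inner_sub_right, real_inner_smul_left]; ring
  rw [e, real_inner_self_eq_norm_sq]
  linarith

/-- The expected progress of one stochastic gradient step. -/
theorem Regular.integral_norm_saStep_sub_sq_le (hG : G.Regular M) (hy : y ∈ G.profiles)
    {z : EuclideanSpace ℝ (Fin (n i))} (hz : z ∈ G.X i) {γ : ℝ} (hγ : 0 ≤ γ) (hμ : 0 < μ) :
    ∫ ω, ‖G.saStep μ i γ y z (G.ξ ω) - G.proxBR μ i y‖ ^ 2 ∂G.P ≤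
      (1 - 2 * γ * μ) * ‖z - G.proxBR μ i y‖ ^ 2 + (γ * μ) ^ 2 * G.Qconst M μ i := by
  have := hG.isProb
  have hw := update_mem_profiles hy hz
  obtain ⟨hgi, hge⟩ := hG.unbiased i _ hw
  obtain ⟨hsi, hse⟩ := hG.second_moment i _ hw
  have hc := (hG.proxBR_spec μ i hy).1
  have hin := hG.mul_norm_sq_le_inner (μ := μ) hy hz
  rw [hge] at hin
  set c := G.proxBR μ i y
  set g : Ω → EuclideanSpace ℝ (Fin (n i)) := fun ω =>
    G.sampleGrad i (Function.update y i z) (G.ξ ω)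
  -- The projection fixes `c` and is nonexpansive, so it can be dropped; the square is then expanded
  -- with `‖u + v‖² ≤ 2‖u‖² + 2‖v‖²`, the source of both factors `2` in `Qconst`.
  have hpt : ∀ ω, ‖G.saStep μ i γ y z (G.ξ ω) - c‖ ^ 2 ≤
      (‖z - c‖ ^ 2 - 2 * γ * μ * inner ℝ (z - c) (z - y i) +
        2 * γ ^ 2 * μ ^ 2 * ‖z - y i‖ ^ 2) +
        ((-2 * γ) * inner ℝ (z - c) (g ω) + 2 * γ ^ 2 * ‖g ω‖ ^ 2) := by
    intro ω
    have h1 := norm_nearestPt_sub_le (hG.compact i) (hG.convex i) ⟨_, hc⟩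
      (z - γ • (g ω + μ • (z - y i))) c
    rw [nearestPt_of_mem (hG.compact i) hc] at h1
    have h2 := pow_le_pow_left₀ (norm_nonneg _) h1 2
    refine h2.trans ?_
    have e : z - γ • (g ω + μ • (z - y i)) - c = (z - c) - γ • (g ω + μ • (z - y i)) := by abel
    rw [e, norm_sub_sq_real, real_inner_smul_right, inner_add_right, real_inner_smul_right,
      norm_smul, mul_pow, Real.norm_eq_abs, sq_abs]
    have h3 : ‖g ω + μ • (z - y i)‖ ^ 2 ≤ 2 * ‖g ω‖ ^ 2 + 2 * (μ ^ 2 * ‖z - y i‖ ^ 2) := by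
      have h4 := pow_le_pow_left₀ (norm_nonneg _) (norm_add_le (g ω) (μ • (z - y i))) 2
      have h5 : ‖μ • (z - y i)‖ ^ 2 = μ ^ 2 * ‖z - y i‖ ^ 2 := by
        rw [norm_smul, mul_pow, Real.norm_eq_abs, sq_abs]
      nlinarith [sq_nonneg (‖g ω‖ - ‖μ • (z - y i)‖)]
    have h6 := mul_le_mul_of_nonneg_left h3 (sq_nonneg γ)
    linarith
  have hii : Integrable (fun ω => inner ℝ (z - c) (g ω)) G.P := hgi.const_inner (z - c)
  have hint : Integrable (fun ω => (-2 * γ) * inner ℝ (z - c) (g ω) + 2 * γ ^ 2 * ‖g ω‖ ^ 2) G.P :=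
    (hii.const_mul _).add (hsi.const_mul _)
  refine (integral_mono_of_nonneg (.of_forall fun ω => by positivity)
    ((integrable_const _).add hint) (.of_forall hpt)).trans ?_
  simp only [Pi.add_apply]
  rw [integral_add (integrable_const _) hint, integral_add (hii.const_mul _) (hsi.const_mul _),
    integral_const_mul, integral_const_mul, integral_inner hgi, integral_const, probReal_univ,
    one_smul]
  rw [real_inner_comm, inner_add_right, real_inner_smul_right] at hin
  have hD := pow_le_pow_left₀ (norm_nonneg _) (hG.norm_sub_le_diam hz (hy i)) 2
  have h1 : (γ * μ) ^ 2 * G.Qconst M μ i =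
      2 * γ ^ 2 * M i ^ 2 + 2 * γ ^ 2 * μ ^ 2 * Metric.diam (G.X i) ^ 2 := by
    rw [Qconst]; field_simp
  have h2 : 2 * γ ^ 2 * μ ^ 2 * ‖z - y i‖ ^ 2 ≤
      2 * γ ^ 2 * μ ^ 2 * Metric.diam (G.X i) ^ 2 := by gcongr
  have h3 := mul_le_mul_of_nonneg_left hse (by positivity : 0 ≤ 2 * γ ^ 2)
  have h4 := mul_le_mul_of_nonneg_left hin (by positivity : 0 ≤ 2 * γ)
  rw [h1]
  linarith

theorem sq_diam_le_Qconst : Metric.diam (G.X i) ^ 2 ≤ G.Qconst M μ i := by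
  have h1 : 0 ≤ 2 * M i ^ 2 / μ ^ 2 := by positivity
  have h2 : 0 ≤ Metric.diam (G.X i) ^ 2 := by positivity
  rw [Qconst]
  linarith

theorem Qconst_nonneg : 0 ≤ G.Qconst M μ i := by rw [Qconst]; positivity

/-! ### The inner loop given the past -/

section Scheme

variable {j : Fin N → ℕ → ℕ} {x₀ : Ω → Profile n}
  {S : Fin N → ℕ → ℕ → Ω → EuclideanSpace ℝ (Fin d)}

/-- The `σ`-field generated by `ℱ_k` and the first `t` samples of player `i` at stage `k`. -/
abbrev stageHistory (j : Fin N → ℕ → ℕ) (x₀ : Ω → Profile n)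
    (S : Fin N → ℕ → ℕ → Ω → EuclideanSpace ℝ (Fin d)) (i : Fin N) (k t : ℕ) : MeasurableSpace Ω :=
  history j x₀ S k ⊔ ⨆ (s : ℕ) (_ : 1 ≤ s ∧ s < t + 1), MeasurableSpace.comap (S i k s) inferInstance

theorem Sampling.history_le (hS : G.Sampling j x₀ S) (k : ℕ) :
    history j x₀ S k ≤ (inferInstance : MeasurableSpace Ω) := by
  refine sup_le hS.init_meas.comap_le ?_
  exact iSup_le fun i => iSup_le fun l => iSup_le fun _ => iSup_le fun t => iSup_le fun ht =>
    (hS.meas i l t ht.1 ht.2).comap_le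

theorem Sampling.syncIter_mem (hS : G.Sampling j x₀ S) (hG : G.Regular M) (k : ℕ) (ω : Ω) :
    G.syncIter μ j x₀ S k ω ∈ G.profiles := by
  induction k with
  | zero => exact hS.init_mem ω
  | succ k ih => exact fun i => hG.saIter_mem ih _ _

omit [MeasurableSpace Ω] in
theorem history_mono : Monotone (history j x₀ S) := by
  intro k l hkl
  refine sup_le_sup le_rfl ?_
  exact iSup_mono fun i => iSup_mono fun r => iSup_mono' fun h => ⟨h.trans_le hkl, le_rfl⟩

theorem Sampling.measurable_syncIter (hS : G.Sampling j x₀ S) (hG : G.Regular M) (k : ℕ) :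
    Measurable[history j x₀ S k] (G.syncIter μ j x₀ S k) := by
  induction k with
  | zero => exact (comap_measurable x₀).mono le_sup_left le_rfl
  | succ k ih =>
    refine (@measurable_pi_iff _ _ _ (history j x₀ S (k + 1)) _ _).2 fun i => ?_
    refine hG.measurable_saIter (ih.mono (history_mono k.le_succ) le_rfl)
      (fun ω => hS.syncIter_mem hG k ω) fun r hr hrt => ?_
    refine (comap_measurable (S i k r)).mono ?_ le_rfl
    refine le_trans ?_ le_sup_right
    exact le_iSup_of_le i <| le_iSup_of_le k <| le_iSup_of_le k.lt_succ_self <|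
      le_iSup_of_le r <| le_iSup_of_le ⟨hr, hrt⟩ le_rfl

theorem Sampling.measurable_syncIter' (hS : G.Sampling j x₀ S) (hG : G.Regular M) (k : ℕ) :
    Measurable (G.syncIter μ j x₀ S k) :=
  (hS.measurable_syncIter hG k).mono (hS.history_le k) le_rfl

theorem Sampling.measurable_proxBR_syncIter (hS : G.Sampling j x₀ S) (hG : G.Regular M)
    (hΓ : G.Contractive μ) (hμ : 0 < μ) (k : ℕ) :
    Measurable fun ω => G.proxBR μ i (G.syncIter μ j x₀ S k ω) :=
  (hΓ.continuous_proxBR hG hμ).measurable.comp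
    ((hS.measurable_syncIter' hG k).subtype_mk (h := hS.syncIter_mem hG k))

theorem Sampling.measurable_saIter (hS : G.Sampling j x₀ S) (hG : G.Regular M) (k : ℕ) {t : ℕ}
    (ht : t ≤ j i k) :
    Measurable fun ω => G.saIter μ i (G.syncIter μ j x₀ S k ω) (fun r => S i k r ω) t :=
  hG.measurable_saIter (hS.measurable_syncIter' hG k) (hS.syncIter_mem hG k)
    fun r hr hrt => hS.meas i k r hr (hrt.trans ht)

theorem Sampling.integrable_norm_saIter_sub_sq (hS : G.Sampling j x₀ S) (hG : G.Regular M)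
    (hΓ : G.Contractive μ) (hμ : 0 < μ) (k : ℕ) {t : ℕ} (ht : t ≤ j i k) :
    Integrable (fun ω => ‖G.saIter μ i (G.syncIter μ j x₀ S k ω) (fun r => S i k r ω) t -
      G.proxBR μ i (G.syncIter μ j x₀ S k ω)‖ ^ 2) G.P := by
  have := hG.isProb
  refine Integrable.of_bound (((hS.measurable_saIter hG k ht).sub
    (hS.measurable_proxBR_syncIter hG hΓ hμ k)).norm.pow_const 2).aestronglyMeasurable
    (Metric.diam (G.X i) ^ 2) (.of_forall fun ω => ?_)
  rw [norm_pow, norm_norm]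
  have hm := hS.syncIter_mem (μ := μ) hG k ω
  gcongr
  exact hG.norm_sub_le_diam (hG.saIter_mem hm _ _) (hG.proxBR_spec μ i hm).1

/-- The current profile and inner iterate are measurable for `stageHistory`, of which the next
sample is independent, so the one-step bound applies with both frozen. -/
theorem Sampling.setIntegral_norm_saStep_sub_sq_le (hS : G.Sampling j x₀ S) (hG : G.Regular M)
    (hΓ : G.Contractive μ) (hμ : 0 < μ) (k : ℕ) {t : ℕ} (ht : t + 1 ≤ j i k) {A : Set Ω}
    (hA : MeasurableSet[history j x₀ S k] A) {γ : ℝ} (hγ : 0 ≤ γ) :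
    ∫ ω in A, ‖G.saStep μ i γ (G.syncIter μ j x₀ S k ω)
        (G.saIter μ i (G.syncIter μ j x₀ S k ω) (fun r => S i k r ω) t) (S i k (t + 1) ω) -
        G.proxBR μ i (G.syncIter μ j x₀ S k ω)‖ ^ 2 ∂G.P ≤
      (1 - 2 * γ * μ) *
        ∫ ω in A, ‖G.saIter μ i (G.syncIter μ j x₀ S k ω) (fun r => S i k r ω) t -
          G.proxBR μ i (G.syncIter μ j x₀ S k ω)‖ ^ 2 ∂G.P +
        (γ * μ) ^ 2 * G.Qconst M μ i * G.P.real A := by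
  have := hG.isProb
  obtain ⟨ω₀⟩ : Nonempty Ω := G.P.nonempty_of_neZero
  have hne : (G.X i).Nonempty := ⟨_, hS.init_mem ω₀ i⟩
  have hH : stageHistory j x₀ S i k t ≤ (inferInstance : MeasurableSpace Ω) := by
    refine sup_le (hS.history_le k) (iSup_le fun s => iSup_le fun hs => ?_)
    exact (hS.meas i k s hs.1 (by omega)).comap_le
  have hY : Measurable[stageHistory j x₀ S i k t] (G.syncIter μ j x₀ S k) :=
    (hS.measurable_syncIter hG k).mono le_sup_left le_rfl
  have hz : Measurable[stageHistory j x₀ S i k t] fun ω =>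
      G.saIter μ i (G.syncIter μ j x₀ S k ω) (fun r => S i k r ω) t := by
    refine hG.measurable_saIter hY (hS.syncIter_mem hG k) fun r hr hrt => ?_
    refine (comap_measurable (S i k r)).mono (le_trans ?_ le_sup_right) le_rfl
    exact le_iSup_of_le r <| le_iSup_of_le ⟨hr, by omega⟩ le_rfl
  let φ : (G.profiles × G.X i) × EuclideanSpace ℝ (Fin d) → ℝ := fun p =>
    ‖G.saStep μ i γ p.1.1 p.1.2 p.2 - G.proxBR μ i p.1.1‖ ^ 2
  have hφ : Measurable φ := ((hG.measurable_saStep hne γ).sub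
    ((hΓ.continuous_proxBR hG hμ).measurable.comp
      (measurable_fst.comp measurable_fst))).norm.pow_const 2
  -- Subtype-valued, since the sampled gradient is jointly measurable only over feasible profiles.
  let Z : Ω → G.profiles × G.X i := fun ω =>
    (⟨G.syncIter μ j x₀ S k ω, hS.syncIter_mem hG k ω⟩,
      ⟨G.saIter μ i (G.syncIter μ j x₀ S k ω) (fun r => S i k r ω) t,
        hG.saIter_mem (hS.syncIter_mem hG k ω) _ _⟩)
  have hZ : Measurable[stageHistory j x₀ S i k t] Z := hY.subtype_mk.prodMk hz.subtype_mk
  have hAH : MeasurableSet[stageHistory j x₀ S i k t] A :=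
    (le_sup_left : history j x₀ S k ≤ stageHistory j x₀ S i k t) _ hA
  have hSm := hS.meas i k (t + 1) (by omega) ht
  have h1 := setIntegral_comp_prodMk_of_indep (P := G.P) hH hZ hSm
    (hS.indep i k (t + 1) (by omega) ht) hAH hφ (C := Metric.diam (G.X i) ^ 2) fun p => by
      rw [abs_of_nonneg (by positivity)]
      have := hG.norm_sub_le_diam (hG.saStep_mem (μ := μ) p.1.1.2 γ p.1.2 p.2)
        (hG.proxBR_spec μ i p.1.1.2).1
      simp only [φ]
      gcongr
  refine (h1.trans_le ?_)
  have hle : ∀ ω, ∫ s, φ (Z ω, s) ∂(G.P.map (S i k (t + 1))) ≤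
      (1 - 2 * γ * μ) * ‖G.saIter μ i (G.syncIter μ j x₀ S k ω) (fun r => S i k r ω) t -
          G.proxBR μ i (G.syncIter μ j x₀ S k ω)‖ ^ 2 + (γ * μ) ^ 2 * G.Qconst M μ i := by
    intro ω
    rw [(hS.law i k (t + 1) (by omega) ht).map_eq, integral_map hG.meas_xi.aemeasurable
      (Measurable.aestronglyMeasurable (f := fun s => φ (Z ω, s))
        (hφ.comp measurable_prodMk_left))]
    exact hG.integral_norm_saStep_sub_sq_le (hS.syncIter_mem hG k ω)
      (hG.saIter_mem (hS.syncIter_mem hG k ω) _ _) hγ hμ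
  have hint := ((hS.integrable_norm_saIter_sub_sq (i := i) hG hΓ hμ k
    (t.le_succ.trans ht)).const_mul (1 - 2 * γ * μ)).integrableOn (s := A)
  refine (integral_mono_of_nonneg (.of_forall fun ω => ?_)
    (hint.add (integrable_const ((γ * μ) ^ 2 * G.Qconst M μ i))) (.of_forall hle)).trans_eq ?_
  · exact integral_nonneg fun s => by positivity
  · rw [integral_add' hint (integrable_const _), integral_const_mul, setIntegral_const,
      smul_eq_mul, mul_comm (G.P.real A)]

/-- The `O(1 / t)` rate of projected stochastic approximation, on each event of the past. -/
theorem Sampling.setIntegral_norm_saIter_sub_sq_le (hS : G.Sampling j x₀ S) (hG : G.Regular M)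
    (hΓ : G.Contractive μ) (hμ : 0 < μ) (k : ℕ) {A : Set Ω}
    (hA : MeasurableSet[history j x₀ S k] A) {t : ℕ} (ht : t ≤ j i k) :
    ∫ ω in A, ‖G.saIter μ i (G.syncIter μ j x₀ S k ω) (fun r => S i k r ω) t -
      G.proxBR μ i (G.syncIter μ j x₀ S k ω)‖ ^ 2 ∂G.P ≤
        G.Qconst M μ i / (t + 1) * G.P.real A := by
  have := hG.isProb
  induction t with
  | zero =>
    refine (integral_mono_of_nonneg (.of_forall fun ω => by positivity)
      (integrable_const (G.Qconst M μ i)) (.of_forall fun ω => ?_)).trans_eq ?_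
    · refine le_trans ?_ sq_diam_le_Qconst
      have hm := hS.syncIter_mem (μ := μ) hG k ω
      exact pow_le_pow_left₀ (norm_nonneg _)
        (hG.norm_sub_le_diam (hG.saIter_mem hm _ _) (hG.proxBR_spec μ i hm).1) 2
    · rw [setIntegral_const, smul_eq_mul]; simp [mul_comm]
  | succ t ih =>
    have h1 := hS.setIntegral_norm_saStep_sub_sq_le hG hΓ hμ k ht hA
      (γ := 1 / (μ * ((t + 1 : ℕ) + 1 : ℝ))) (by positivity)
    simp only [saIter_succ]
    refine h1.trans ?_
    have h2 := ih (t.le_succ.trans ht)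
    have e1 : 1 / (μ * ((t + 1 : ℕ) + 1 : ℝ)) * μ = 1 / ((t : ℝ) + 2) := by
      push_cast; field_simp; ring
    have e2 : 1 - 2 * (1 / (μ * ((t + 1 : ℕ) + 1 : ℝ))) * μ = (t : ℝ) / (t + 2) := by
      rw [mul_assoc, e1]; field_simp; ring
    rw [e1, e2]
    -- With factor `1 - 2/(t+2) = t/(t+2)` the induction closes because `t/((t+2)(t+1)) + 1/(t+2)² ≤
    -- 1/(t+2)`, that is, `1/(t+2) ≤ 1/(t+1)`.
    refine (add_le_add_left (mul_le_mul_of_nonneg_left h2 (by positivity)) _).trans ?_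
    rw [← mul_assoc, ← add_mul]
    refine mul_le_mul_of_nonneg_right ?_ measureReal_nonneg
    have hQ : 0 ≤ G.Qconst M μ i := Qconst_nonneg
    have e3 : (t : ℝ) / (t + 2) * (G.Qconst M μ i / (t + 1)) +
        (1 / ((t : ℝ) + 2)) ^ 2 * G.Qconst M μ i =
        G.Qconst M μ i * ((t : ℝ) / ((t + 2) * (t + 1)) + 1 / (t + 2) ^ 2) := by
      field_simp
    have e4 : G.Qconst M μ i / ((t + 1 : ℕ) + 1) = G.Qconst M μ i * (1 / ((t : ℝ) + 2)) := by
      push_cast; rw [mul_one_div]; congr 1; ring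
    rw [e3, e4]
    refine mul_le_mul_of_nonneg_left ?_ hQ
    rw [div_add_div _ _ (by positivity) (by positivity), div_le_div_iff₀ (by positivity)
      (by positivity)]
    have : (0 : ℝ) ≤ t := by positivity
    nlinarith [mul_nonneg this this, mul_nonneg (mul_nonneg this this) this]

theorem Sampling.setIntegral_norm_syncIter_sub_sq_le {η : ℝ} (hη : 0 < η)
    (hS : G.Sampling (G.innerSteps M μ η) x₀ S) (hG : G.Regular M)
    (hΓ : G.Contractive μ) (hμ : 0 < μ) (i : Fin N) (k : ℕ) {A : Set Ω}
    (hA : MeasurableSet[history (G.innerSteps M μ η) x₀ S k] A) :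
    ∫ ω in A, ‖G.syncIter μ (G.innerSteps M μ η) x₀ S (k + 1) ω i -
      G.proxBR μ i (G.syncIter μ (G.innerSteps M μ η) x₀ S k ω)‖ ^ 2 ∂G.P ≤
        (η ^ (k + 1)) ^ 2 * G.P.real A := by
  refine (hS.setIntegral_norm_saIter_sub_sq_le hG hΓ hμ k hA (i := i) le_rfl).trans ?_
  refine mul_le_mul_of_nonneg_right ?_ measureReal_nonneg
  have h1 : G.Qconst M μ i / η ^ (2 * (k + 1)) ≤ G.innerSteps M μ η i k := Nat.le_ceil _
  rw [div_le_iff₀ (by positivity)] at h1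
  rw [div_le_iff₀ (by positivity), ← pow_mul, mul_comm (k + 1) 2]
  have : 0 < η ^ (2 * (k + 1)) := by positivity
  linarith

theorem Sampling.isInexactBR {η : ℝ} (hη : 0 < η)
    (hS : G.Sampling (G.innerSteps M μ η) x₀ S) (hG : G.Regular M)
    (hΓ : G.Contractive μ) (hμ : 0 < μ) (i : Fin N) (k : ℕ) :
    G.IsInexactBR μ (history (G.innerSteps M μ η) x₀ S) i k (η ^ (k + 1))
      (G.syncIter μ (G.innerSteps M μ η) x₀ S k)
      (fun ω => G.syncIter μ (G.innerSteps M μ η) x₀ S (k + 1) ω i) := by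
  have := hG.isProb
  have hint := hS.integrable_norm_saIter_sub_sq (i := i) hG hΓ hμ k le_rfl
  exact ⟨fun ω => hS.syncIter_mem hG (k + 1) ω i, hint,
    condExp_le_of_forall_setIntegral_le (hS.history_le k) hint fun A hA =>
      hS.setIntegral_norm_syncIter_sub_sq_le hη hG hΓ hμ i k hA⟩

end Scheme

end StochGame

/-! ### Counting stages and gradient steps -/

theorem pow_mul_le_one_of_ceil_log_le {η L : ℝ} (hη : 0 < η) (hη1 : η < 1) (hL : 0 ≤ L) {k : ℕ}
    (hk : ⌈Real.log L / Real.log (1 / η)⌉₊ ≤ k) : η ^ k * L ≤ 1 := by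
  rcases hL.eq_or_lt with rfl | hL
  · simp
  have hlog : 0 < Real.log (1 / η) := Real.log_pos (by rw [lt_div_iff₀ hη]; linarith)
  have h1 := (div_le_iff₀ hlog).1 (Nat.ceil_le.1 hk)
  rw [← Real.log_pow, Real.log_le_log_iff hL (by positivity), one_div, inv_pow] at h1
  calc η ^ k * L ≤ η ^ k * (η ^ k)⁻¹ := by gcongr
    _ = 1 := mul_inv_cancel₀ (by positivity)

/-- Each rounding up costs at most one step per stage, which produces the second term; the rest is a
geometric sum dominated by its last stage. -/
theorem sum_ceil_div_pow_le {Q η L : ℝ} (hQ : 0 ≤ Q) (hη : 0 < η) (hη1 : η < 1) (hL : 0 < L) :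
    ((∑ k ∈ Finset.range ⌈Real.log L / Real.log (1 / η)⌉₊, ⌈Q / η ^ (2 * (k + 1))⌉₊ : ℕ) : ℝ) ≤
      Q / (η ^ 4 * Real.log (1 / η ^ 2)) * L ^ 2 + (⌈Real.log L / Real.log (1 / η)⌉₊ : ℝ) := by
  set q : ℝ := 1 / η ^ 2 with hq
  have hη2 : η ^ 2 < 1 := pow_lt_one₀ hη.le hη1 two_ne_zero
  have hq1 : 1 < q := by rw [hq, lt_div_iff₀ (by positivity)]; linarith
  have hlogq : 0 < Real.log q := Real.log_pos hq1
  have hlog : 0 < Real.log (1 / η) := Real.log_pos (by rw [lt_div_iff₀ hη]; linarith)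
  have hgeom : ∑ k ∈ Finset.range ⌈Real.log L / Real.log (1 / η)⌉₊, q ^ (k + 1) ≤
      q ^ 2 * L ^ 2 / Real.log q := by
    rcases hK : ⌈Real.log L / Real.log (1 / η)⌉₊ with _ | m
    · simp only [Finset.range_zero, Finset.sum_empty]; positivity
    -- The last stage index is strictly below the unrounded threshold, hence `q ^ m ≤ L ^ 2`. The
    -- two further powers of `q` in the sum give the `η ^ 4`.
    have hm : (m : ℝ) < Real.log L / Real.log (1 / η) := Nat.lt_ceil.1 (by omega)
    rw [lt_div_iff₀ hlog, ← Real.log_pow, Real.log_lt_log_iff (by positivity) hL] at hm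
    have hqm : q ^ m ≤ L ^ 2 := by
      have h := pow_le_pow_left₀ (by positivity) hm.le 2
      rwa [← pow_mul, mul_comm m 2, pow_mul, one_div_pow] at h
    have hq0 : 0 < q := by linarith
    calc ∑ k ∈ Finset.range (m + 1), q ^ (k + 1)
        = (q ^ (m + 2) - q) / (q - 1) := by
          simp only [pow_succ]
          rw [← Finset.sum_mul, geom_sum_eq hq1.ne']
          ring
      _ ≤ q ^ 2 * L ^ 2 / Real.log q := by
          gcongr
          · rw [pow_add]
            have : q ^ m * q ^ 2 ≤ L ^ 2 * q ^ 2 := by gcongr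
            linarith
          -- The denominator `q - 1` of the geometric sum is traded for the smaller `log q`.
          · exact Real.log_le_sub_one_of_pos hq0
  have hceil : ∀ k : ℕ, (⌈Q / η ^ (2 * (k + 1))⌉₊ : ℝ) ≤ Q * q ^ (k + 1) + 1 := fun k => by
    have h := (Nat.ceil_lt_add_one (a := Q / η ^ (2 * (k + 1))) (by positivity)).le
    have e : Q / η ^ (2 * (k + 1)) = Q * q ^ (k + 1) := by
      rw [pow_mul, div_eq_mul_one_div, ← one_div_pow, ← hq]
    rwa [e] at h ⊢
  push_cast
  refine (Finset.sum_le_sum fun k _ => hceil k).trans ?_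
  rw [Finset.sum_add_distrib, ← Finset.mul_sum]
  simp only [Finset.sum_const, Finset.card_range, nsmul_eq_mul, mul_one]
  refine add_le_add ((mul_le_mul_of_nonneg_left hgeom hQ).trans_eq ?_) le_rfl
  rw [hq]
  field_simp

/-- The squared term is exactly of order `N/ε²`. The logarithmic one is absorbed using `log r ≤ r`,
`√N ≤ N`, `ε² ≤ ε` and `1 ≤ N/ε²`. -/
theorem stepBound_le {Q η B : ℝ} (hη : 0 < η) (hη1 : η < 1) (hB : 0 ≤ B)
    {N : ℕ} {ε : ℝ} (hN : 1 ≤ N) (hε : 0 < ε) (hε1 : ε ≤ 1) :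
    Q / (η ^ 4 * Real.log (1 / η ^ 2)) * (√(N : ℝ) * B / ε) ^ 2 +
      (⌈Real.log (√(N : ℝ) / ε * B) / Real.log (1 / η)⌉₊ : ℝ) ≤
      (Q / (η ^ 4 * Real.log (1 / η ^ 2)) * B ^ 2 + B / Real.log (1 / η) + 1) * (N / ε ^ 2) := by
  have hlog : 0 < Real.log (1 / η) := Real.log_pos (by rw [lt_div_iff₀ hη]; linarith)
  have hN1 : (1 : ℝ) ≤ N := by exact_mod_cast hN
  have hs : √(N : ℝ) ≤ N := (Real.sqrt_le_left (by positivity)).2 (by nlinarith)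
  have hεε : ε ^ 2 ≤ ε := by nlinarith
  have h1 : √(N : ℝ) / ε ≤ N / ε ^ 2 := by gcongr
  have h2 : (1 : ℝ) ≤ N / ε ^ 2 := by
    rw [le_div_iff₀ (by positivity)]; linarith
  have h3 : (⌈Real.log (√(N : ℝ) / ε * B) / Real.log (1 / η)⌉₊ : ℝ) ≤
      N / ε ^ 2 * B / Real.log (1 / η) + 1 := by
    refine le_trans ?_ (Nat.ceil_lt_add_one (by positivity)).le
    refine Nat.cast_le.2 (Nat.ceil_mono ?_)
    gcongr
    exact (Real.log_le_self (by positivity)).trans (by gcongr)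
  have h4 : (√(N : ℝ) * B / ε) ^ 2 = B ^ 2 * (N / ε ^ 2) := by
    rw [div_pow, mul_pow, Real.sq_sqrt (by positivity)]; ring
  rw [h4]
  calc _ ≤ Q / (η ^ 4 * Real.log (1 / η ^ 2)) * (B ^ 2 * (N / ε ^ 2)) +
        (N / ε ^ 2 * B / Real.log (1 / η) + N / ε ^ 2) := by linarith
    _ = _ := by ring

/-! ### Moments of the distance vector -/

theorem sq_integral_le_integral_sq {Ω : Type*} [MeasurableSpace Ω] {P : Measure Ω}
    [IsProbabilityMeasure P] {f : Ω → ℝ} (hf : MemLp f 2 P) :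
    (∫ ω, f ω ∂P) ^ 2 ≤ ∫ ω, f ω ^ 2 ∂P := by
  have h := variance_nonneg f P
  rw [variance_eq_sub hf] at h
  simpa using h

section DistVec

variable {N : ℕ} {n : Fin N → ℕ} {Ω : Type*} [MeasurableSpace Ω] {P : Measure Ω}
  {U V : Ω → Profile n}

theorem norm_distVec_sq (x y : Profile n) : ‖distVec x y‖ ^ 2 = ∑ i, ‖x i - y i‖ ^ 2 := by
  rw [EuclideanSpace.norm_sq_eq]
  simp [distVec]

theorem norm_distVec_triangle (x y z : Profile n) :
    ‖distVec x z‖ ≤ ‖distVec x y‖ + ‖distVec y z‖ := by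
  simp only [StochGame.norm_distVec_eq]
  exact dist_triangle _ _ _

theorem memLp_norm_distVec (h : ∀ i, Integrable (fun ω => ‖U ω i - V ω i‖ ^ 2) P) :
    MemLp (fun ω => ‖distVec (U ω) (V ω)‖) 2 P := by
  have h1 : Integrable (fun ω => ‖distVec (U ω) (V ω)‖ ^ 2) P := by
    simp only [norm_distVec_sq]
    exact integrable_finsetSum _ fun i _ => h i
  refine (memLp_two_iff_integrable_sq ?_).2 h1
  -- Measurability of the norm is recovered from that of its square.
  have h2 := Real.continuous_sqrt.comp_aestronglyMeasurable h1.aestronglyMeasurable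
  simpa [Real.sqrt_sq] using h2

theorem integral_norm_distVec_le [IsProbabilityMeasure P] {c : ℝ} (hc : 0 ≤ c)
    (h : ∀ i, Integrable (fun ω => ‖U ω i - V ω i‖ ^ 2) P)
    (hle : ∀ i, ∫ ω, ‖U ω i - V ω i‖ ^ 2 ∂P ≤ c ^ 2) :
    ∫ ω, ‖distVec (U ω) (V ω)‖ ∂P ≤ √(N : ℝ) * c := by
  have h1 := sq_integral_le_integral_sq (memLp_norm_distVec h)
  simp only [norm_distVec_sq] at h1
  rw [integral_finsetSum _ fun i _ => h i] at h1
  have h2 := h1.trans (Finset.sum_le_sum fun i _ => hle i)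
  refine abs_le_of_sq_le_sq' ?_ (by positivity) |>.2
  rw [mul_pow, Real.sq_sqrt (by positivity)]
  simpa using h2

end DistVec

/-! ### Convergence of the outer loop -/

namespace StochGame

variable {N : ℕ} {n : Fin N → ℕ} {d : ℕ} {Ω : Type*} [MeasurableSpace Ω]
  {G : StochGame n d Ω} {M : Fin N → ℝ} {μ : ℝ} {i : Fin N} {xs : Profile n}
  {j : Fin N → ℕ → ℕ} {x₀ : Ω → Profile n} {S : Fin N → ℕ → ℕ → Ω → EuclideanSpace ℝ (Fin d)}

theorem Sampling.integrable_norm_syncIter_sub_sq (hS : G.Sampling j x₀ S) (hG : G.Regular M)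
    (hxs : xs ∈ G.profiles) (k : ℕ) (i : Fin N) :
    Integrable (fun ω => ‖G.syncIter μ j x₀ S k ω i - xs i‖ ^ 2) G.P := by
  have := hG.isProb
  refine Integrable.of_bound (((((measurable_pi_apply i).comp
    (hS.measurable_syncIter' hG k)).sub_const (xs i)).norm.pow_const 2).aestronglyMeasurable)
    (Metric.diam (G.X i) ^ 2) (.of_forall fun ω => ?_)
  rw [norm_pow, norm_norm]
  gcongr
  exact hG.norm_sub_le_diam (hS.syncIter_mem hG k ω i) (hxs i)

/-- Triangle inequality through the exact best responses to the current profile: the inexactness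
costs `√N η^{k+1}`, and the contraction towards the fixed point `xs` holds pointwise in `ω`. -/
theorem Sampling.integral_norm_distVec_syncIter_succ_le {η : ℝ} (hη : 0 < η)
    (hS : G.Sampling (G.innerSteps M μ η) x₀ S) (hG : G.Regular M)
    (hΓ : G.Contractive μ) (hμ : 0 < μ) (hxs : G.IsNash xs) (k : ℕ) :
    ∫ ω, ‖distVec (G.syncIter μ (G.innerSteps M μ η) x₀ S (k + 1) ω) xs‖ ∂G.P ≤
      √(N : ℝ) * η ^ (k + 1) +
        G.contr μ * ∫ ω, ‖distVec (G.syncIter μ (G.innerSteps M μ η) x₀ S k ω) xs‖ ∂G.P := by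
  have := hG.isProb
  obtain ⟨hxm, hfix⟩ := (isNash_iff_proxBR hG hΓ hμ).1 hxs
  have hint : ∀ i, Integrable (fun ω =>
      ‖G.syncIter μ (G.innerSteps M μ η) x₀ S (k + 1) ω i -
        G.proxBR μ i (G.syncIter μ (G.innerSteps M μ η) x₀ S k ω)‖ ^ 2) G.P := fun i =>
    hS.integrable_norm_saIter_sub_sq (i := i) hG hΓ hμ k le_rfl
  have h1 := integral_norm_distVec_le (P := G.P)
    (U := G.syncIter μ (G.innerSteps M μ η) x₀ S (k + 1))
    (V := fun ω i => G.proxBR μ i (G.syncIter μ (G.innerSteps M μ η) x₀ S k ω))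
    (c := η ^ (k + 1)) (by positivity) hint fun i => by
      simpa using hS.setIntegral_norm_syncIter_sub_sq_le hη hG hΓ hμ i k MeasurableSet.univ
  have hi1 := (memLp_norm_distVec (U := G.syncIter μ (G.innerSteps M μ η) x₀ S (k + 1))
    (V := fun ω i => G.proxBR μ i (G.syncIter μ (G.innerSteps M μ η) x₀ S k ω)) hint).integrable
    one_le_two
  have hi2 := ((memLp_norm_distVec (V := fun _ => xs)
    (hS.integrable_norm_syncIter_sub_sq (μ := μ) hG hxm k)).integrable one_le_two).const_mul
    (G.contr μ)
  refine le_trans ?_ (add_le_add h1 (integral_const_mul _ _).le)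
  rw [← integral_add hi1 hi2]
  refine integral_mono_of_nonneg (.of_forall fun ω => norm_nonneg _) (hi1.add hi2)
    (.of_forall fun ω => ?_)
  refine (norm_distVec_triangle _ _ _).trans (add_le_add le_rfl ?_)
  have h2 := hΓ.norm_distVec_proxBR_le hG hμ (hS.syncIter_mem (μ := μ) hG k ω) hxm
  rwa [hfix] at h2

/-- Geometric convergence of the synchronous scheme to the equilibrium. -/
theorem Sampling.integral_norm_distVec_syncIter_le {η : ℝ} (hη : G.contr μ < η)
    (hS : G.Sampling (G.innerSteps M μ η) x₀ S) (hG : G.Regular M)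
    (hΓ : G.Contractive μ) (hμ : 0 < μ) (hxs : G.IsNash xs) {C : ℝ} (hC : 0 ≤ C)
    (h0 : ∀ i, ∫ ω, ‖x₀ ω i - xs i‖ ^ 2 ∂G.P ≤ C ^ 2) (k : ℕ) :
    ∫ ω, ‖distVec (G.syncIter μ (G.innerSteps M μ η) x₀ S k ω) xs‖ ∂G.P ≤
      √(N : ℝ) * (C + η / (η - G.contr μ)) * η ^ k := by
  have := hG.isProb
  have ha : 0 ≤ G.contr μ := contr_nonneg
  have hη0 : 0 < η := ha.trans_lt hη
  have hηa : 0 < η - G.contr μ := sub_pos.2 hη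
  induction k with
  | zero =>
    have h := integral_norm_distVec_le (V := fun _ => xs) hC
      (hS.integrable_norm_syncIter_sub_sq (μ := μ) hG hxs.1 0) h0
    refine h.trans ?_
    rw [pow_zero, mul_one]
    gcongr
    have : 0 ≤ η / (η - G.contr μ) := by positivity
    linarith
  | succ k ih =>
    refine (hS.integral_norm_distVec_syncIter_succ_le hη0 hG hΓ hμ hxs k).trans ?_
    refine (add_le_add le_rfl (mul_le_mul_of_nonneg_left ih ha)).trans ?_
    -- The value `b = η/(η-a)` solves `b η = η + a b`, so it exactly absorbs the inexactness; what
    -- is left over comes from `C`.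
    have e : √(N : ℝ) * (C + η / (η - G.contr μ)) * η ^ (k + 1) -
        (√(N : ℝ) * η ^ (k + 1) +
          G.contr μ * (√(N : ℝ) * (C + η / (η - G.contr μ)) * η ^ k)) =
        √(N : ℝ) * C * η ^ k * (η - G.contr μ) := by
      field_simp
      ring
    have : 0 ≤ √(N : ℝ) * C * η ^ k * (η - G.contr μ) := by positivity
    linarith

end StochGame

theorem mainTheorem5 {N : ℕ} {n : Fin N → ℕ} {d : ℕ} {Ω : Type*} [MeasurableSpace Ω]
    (G : StochGame n d Ω) (M : Fin N → ℝ) (hG : G.Regular M)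
    (μ : ℝ) (hμ : 0 < μ) (hΓ : G.Contractive μ)
    (η : ℝ) (hη : G.contr μ < η) (hη1 : η < 1)
    (x₀ : Ω → Profile n) (S : Fin N → ℕ → ℕ → Ω → EuclideanSpace ℝ (Fin d))
    (hS : G.Sampling (G.innerSteps M μ η) x₀ S) :
    -- the Nash equilibrium exists and is unique
    (∃! xs : Profile n, G.IsNash xs) ∧
    -- the inner steps yield inexact best responses to accuracy `η ^ (k + 1)`
    (∀ (i : Fin N) (k : ℕ),
      G.IsInexactBR μ (StochGame.history (G.innerSteps M μ η) x₀ S) i k (η ^ (k + 1))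
        (G.syncIter μ (G.innerSteps M μ η) x₀ S k)
        (fun ω => G.syncIter μ (G.innerSteps M μ η) x₀ S (k + 1) ω i)) ∧
    ∀ (xs : Profile n), G.IsNash xs → ∀ (C : ℝ), 0 ≤ C →
      (∀ i, ∫ ω, ‖x₀ ω i - xs i‖ ^ 2 ∂G.P ≤ C ^ 2) →
      -- the number of projected gradient steps to reach an `ε`-NE₂
      (∀ ε : ℝ, 0 < ε → ∃ K : ℕ,
        (∀ k, K ≤ k → G.IsEpsNE2 xs ε (G.syncIter μ (G.innerSteps M μ η) x₀ S k)) ∧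
        ∀ i, ((∑ k ∈ Finset.range K, G.innerSteps M μ η i k : ℕ) : ℝ) ≤
          stepBound (G.Qconst M μ i) η (G.contr μ) C N ε) ∧
      -- the bound is of order `N / ε ^ 2`
      (∀ i, ∃ B : ℝ, ∀ (N' : ℕ) (ε : ℝ), 1 ≤ N' → 0 < ε → ε ≤ 1 →
        stepBound (G.Qconst M μ i) η (G.contr μ) C N' ε ≤ B * (N' / ε ^ 2)) := by
  have := hG.isProb
  have hη0 : 0 < η := StochGame.contr_nonneg.trans_lt hη
  have hηa : 0 < η - G.contr μ := sub_pos.2 hη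
  obtain ⟨ω₀⟩ : Nonempty Ω := G.P.nonempty_of_neZero
  refine ⟨StochGame.existsUnique_isNash hG hΓ hμ ⟨_, hS.init_mem ω₀⟩,
    fun i k => hS.isInexactBR hη0 hG hΓ hμ i k, fun xs hxs C hC h0 => ?_⟩
  have hB : 0 < C + η / (η - G.contr μ) := by positivity
  -- `K` is the least number of stages with `√N (C + η/(η-a)) η^K ≤ ε`.
  refine ⟨fun ε hε => ⟨⌈Real.log (√(N : ℝ) / ε * (C + η / (η - G.contr μ))) /
    Real.log (1 / η)⌉₊, fun k hk => ⟨?_, ?_⟩, fun i => ?_⟩, fun i => ⟨_, fun N' ε hN hε hε1 =>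
      stepBound_le hη0 hη1 hB.le hN hε hε1⟩⟩
  · exact (memLp_norm_distVec (V := fun _ => xs)
      (hS.integrable_norm_syncIter_sub_sq (μ := μ) hG hxs.1 k)).integrable one_le_two
  · refine (hS.integral_norm_distVec_syncIter_le hη hG hΓ hμ hxs hC h0 k).trans ?_
    have h1 := pow_mul_le_one_of_ceil_log_le hη0 hη1 (by positivity) hk
    calc √(N : ℝ) * (C + η / (η - G.contr μ)) * η ^ k
        = ε * (η ^ k * (√(N : ℝ) / ε * (C + η / (η - G.contr μ)))) := by field_simp
      _ ≤ ε * 1 := by gcongr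
      _ = ε := mul_one ε
  -- The existence of player `i` rules out `N = 0`, making the argument of the logarithm positive.
  · have hN : 0 < (N : ℝ) := Nat.cast_pos.2 i.pos
    have h := sum_ceil_div_pow_le (StochGame.Qconst_nonneg (G := G) (M := M) (μ := μ) (i := i))
      hη0 hη1 (L := √(N : ℝ) / ε * (C + η / (η - G.contr μ))) (by positivity)
    rw [stepBound, mul_div_right_comm]
    exact h
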